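/- Let $n\ge 4$ and $t$ be integers with $0\le t\le n-4$, and let $\alpha\ge 0$ be a real number. For a finite simple graph $G$ let $A(G)$ be its adjacency matrix and $D(G)$ the diagonal matrix of its vertex degrees, and let $\Theta(G,\alpha)$ denote the largest eigenvalue of $A(G)+\alpha D(G)$. A unicyclic graph is a connected simple graph with as many edges as vertices. A $t$-cone unicyclic graph with $n$ vertices is a join $K_t\vee H$ of the complete graph $K_t$ (the null graph if $t=0$) and a unicyclic graph $H$ with $n-t$ vertices, that is, the graph obtained from the disjoint union of $K_t$ and $H$ by joining each vertex of $K_t$ to each vertex of $H$. For a sequence $\pi=(d_1,\dots,d_n)$ with $d_1\ge d_2\ge\dots\ge d_n$, let $\Gamma(\pi,t;1)$ be the class of $t$-cone unicyclic graphs with $n$ vertices whose vertex degrees, listed in non-increasing order, are $d_1,\dots,d_n$. Call $G$ a $\Theta_\alpha$-maximal graph of $\Gamma(\pi,t;1)$ if $G\in\Gamma(\pi,t;1)$ and $\Theta(G_1,\alpha)\le\Theta(G,\alpha)$ for all $G_1\in\Gamma(\pi,t;1)$. Let $\pi=(d_1,\dots,d_n)$ and $\pi'=(d'_1,\dots,d'_n)$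 be non-increasing degree sequences of $t$-cone unicyclic graphs with $n$ vertices such that $\pi\lhd\pi'$, i.e. $\pi\ne\pi'$, $\sum_{i=1}^n d_i=\sum_{i=1}^n d'_i$, and $\sum_{i=1}^k d_i\le\sum_{i=1}^k d'_i$ for $k=1,\dots,n-1$. If $G_\pi$ and $G_{\pi'}$ are $\Theta_\alpha$-maximal graphs of $\Gamma(\pi,t;1)$ and $\Gamma(\pi',t;1)$, respectively, then $$\Theta(G_\pi,\alpha)<\Theta(G_{\pi'},\alpha).$$ -/

import Mathlib

namespace TCone

open Classical in
/-- The general matrix `M_α(G) = A(G) + α D(G)`. -/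
noncomputable def generalMatrix {V : Type*} [Fintype V] (G : SimpleGraph V) (α : ℝ) :
    Matrix V V ℝ :=
  G.adjMatrix ℝ + α • G.degMatrix ℝ

open Classical in
/-- The general spectral radius `Θ(G, α)`: the maximal (real) eigenvalue of `M_α(G)`. -/
noncomputable def Theta {V : Type*} [Fintype V] (G : SimpleGraph V) (α : ℝ) : ℝ :=
  sSup {μ : ℝ | Module.End.HasEigenvalue (Matrix.toLin' (generalMatrix G α)) μ}

open Classical in
/-- On a nonempty vertex set, `Theta G α` is indeed the largest eigenvalue of `M_α(G)`. -/
theorem isGreatest_Theta {V : Type*} [Fintype V] [Nonempty V] (G : SimpleGraph V) (α : ℝ) :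
    IsGreatest {μ : ℝ | Module.End.HasEigenvalue (Matrix.toLin' (generalMatrix G α)) μ}
      (Theta G α) := by
  have h : (generalMatrix G α).IsSymm :=
    (G.isSymm_adjMatrix (α := ℝ)).add ((G.isSymm_degMatrix ℝ).smul α)
  have hH : (generalMatrix G α).IsHermitian := by
    rw [Matrix.IsHermitian, Matrix.conjTranspose_eq_transpose_of_trivial]
    exact h
  have hset : {μ : ℝ | Module.End.HasEigenvalue (Matrix.toLin' (generalMatrix G α)) μ}
      = Set.range hH.eigenvalues := by
    ext μ
    rw [← hH.spectrum_real_eq_range_eigenvalues, ← Matrix.spectrum_toLin']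
    exact Module.End.hasEigenvalue_iff_mem_spectrum
  have hT : Theta G α = sSup (Set.range hH.eigenvalues) := by
    rw [← hset]
    rfl
  rw [hset, hT]
  exact ⟨(Set.range_nonempty _).csSup_mem (Set.finite_range _),
    fun x hx => le_csSup (Set.finite_range _).bddAbove hx⟩

/-- A `c`-cyclic graph: a connected simple graph with `m` edges and `n` vertices, where
`m = n + c - 1`. -/
def IsCyclic {V : Type*} [Fintype V] (c : ℕ) (G : SimpleGraph V) : Prop :=
  G.Connected ∧ G.edgeSet.ncard + 1 = Fintype.card V + c

/-- The join `G ∨ H`: the disjoint union together with all edges between the two parts. -/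
def join {V W : Type*} (G : SimpleGraph V) (H : SimpleGraph W) : SimpleGraph (V ⊕ W) :=
  (G ⊕g H) ⊔ completeBipartiteGraph V W

/-- A `t`-cone `c`-cyclic graph: (isomorphic to) the join `K_t ∨ H` with `H` a `c`-cyclic graph;
for `t = 0` the graph `K_0` is the null graph. -/
def IsCone {V : Type*} (t c : ℕ) (G : SimpleGraph V) : Prop :=
  ∃ (m : ℕ) (H : SimpleGraph (Fin m)),
    IsCyclic c H ∧ Nonempty (G ≃g join (⊤ : SimpleGraph (Fin t)) H)

open Classical in
/-- `π` is the degree sequence of `G`: the degrees of `G`, listed in non-increasing order. -/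
def IsDegreeSequence {n : ℕ} (G : SimpleGraph (Fin n)) (π : Fin n → ℕ) : Prop :=
  Antitone π ∧ ∃ σ : Equiv.Perm (Fin n), ∀ i, G.degree (σ i) = π i

/-- The class `Γ(π, t; c)` of `t`-cone `c`-cyclic graphs with degree sequence `π`. -/
def Gam {n : ℕ} (π : Fin n → ℕ) (t c : ℕ) : Set (SimpleGraph (Fin n)) :=
  {G | IsCone t c G ∧ IsDegreeSequence G π}

/-- `G` is a `Θ_α`-maximal graph of the class `𝒢`. -/
def IsThetaMaximal {n : ℕ} (α : ℝ) (𝒢 : Set (SimpleGraph (Fin n))) (G : SimpleGraph (Fin n)) :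
    Prop :=
  G ∈ 𝒢 ∧ ∀ G₁ ∈ 𝒢, Theta G₁ α ≤ Theta G α

/-- Strict majorization `π ◁ π'` of (non-increasing) sequences of length `n`; the sum of the
first `k` terms is the sum over the indices `i : Fin n` with `i < k`. -/
def StrictlyMajorizedBy {n : ℕ} (π π' : Fin n → ℕ) : Prop :=
  π ≠ π' ∧ ∑ i, π i = ∑ i, π' i ∧
    ∀ k : ℕ, 1 ≤ k → k ≤ n - 1 →
      ∑ i : Fin n with i.val < k, π i ≤ ∑ i : Fin n with i.val < k, π' i

end TCone

/-! The strict majorization is broken into transfers of one unit of degree from a later to an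
earlier entry (`StrictlyMajorizedBy.exists_transfer`). It suffices that a maximal graph of one class
can be changed into a graph of the next class with larger `Theta`. Passing to a maximal graph there
and inducting on the distance between the sequences gives the theorem (`exists_Theta_lt`). No
realizability of the intermediate sequences is needed in advance: the transfer itself produces a
graph.

Both entries of a transfer belong to vertices u, v of the unicyclic part H, with deg v ≤ deg u. The
transfer replaces an edge vw by uw. If the Perron vector f of the cone satisfies f v ≤ f u, its
quadratic form does not drop, and its image changes at u, so `Theta` grows strictly (`quad_slide`,
`exists_perron`). In a maximal cone a larger degree forces a larger Perron entry
(`lt_of_degree_lt`), so f u < f v can occur only for equal degrees, and then the edge is moved the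
other way.

The obstacle is finding a w for which the new graph is simple and connected. Two vertices of a
unicyclic graph have at most two `shared` neighbours, so the move is blocked only if deg v = 2 and v
lies with u on a triangle or 4-cycle. Majorization then supplies a fourth vertex of H that is not a
leaf. Using it, either another vertex of degree 2 replaces v, or a cycle edge can be switched with a
pendant edge, which raises `Theta` at fixed degrees and contradicts maximality (`no_leaf_switch`,
`exists_movable`). -/

namespace TCone

/-! ### Rayleigh quotients and the Perron vector -/

open Classical in
theorem generalMatrix_mulVec {V : Type*} [Fintype V] (G : SimpleGraph V) (α : ℝ) (x : V → ℝ)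
    (v : V) :
    (generalMatrix G α).mulVec x v = ∑ w, if G.Adj v w then x w + α * x v else 0 := by
  have h : ∀ w, (if G.Adj v w then x w + α * x v else 0)
      = (if G.Adj v w then x w else 0) + (if G.Adj v w then 1 else 0) * (α * x v) := by
    intro w; split_ifs <;> simp
  rw [Finset.sum_congr rfl fun w _ => h w, Finset.sum_add_distrib, ← Finset.sum_mul]
  have hd : ((G.degree v : ℕ) : ℝ) = ∑ w, if G.Adj v w then (1 : ℝ) else 0 := by
    rw [← SimpleGraph.card_neighborFinset_eq_degree, SimpleGraph.neighborFinset_eq_filter]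
    simp
  rw [← hd]
  simp only [generalMatrix, Matrix.add_mulVec, Matrix.smul_mulVec, Pi.add_apply, Pi.smul_apply,
    SimpleGraph.adjMatrix_mulVec_apply, SimpleGraph.degMatrix, Matrix.mulVec_diagonal, smul_eq_mul]
  rw [SimpleGraph.neighborFinset_eq_filter, Finset.sum_filter]
  ring

theorem generalMatrix_isHermitian {V : Type*} [Fintype V] (G : SimpleGraph V) (α : ℝ) :
    (generalMatrix G α).IsHermitian := by
  classical
  rw [Matrix.IsHermitian, Matrix.conjTranspose_eq_transpose_of_trivial]
  exact (G.isSymm_adjMatrix (α := ℝ)).add ((G.isSymm_degMatrix ℝ).smul α)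

open Classical in
theorem hasEigenvalue_iff {V : Type*} [Fintype V] (M : Matrix V V ℝ) (μ : ℝ) :
    Module.End.HasEigenvalue (Matrix.toLin' M) μ ↔ ∃ x : V → ℝ, x ≠ 0 ∧ M.mulVec x = μ • x := by
  constructor
  · intro h
    obtain ⟨x, hx⟩ := h.exists_hasEigenvector
    exact ⟨x, hx.2, by simpa using hx.apply_eq_smul⟩
  · rintro ⟨x, h0, hx⟩
    exact Module.End.hasEigenvalue_of_hasEigenvector
      (Module.End.hasEigenvector_iff.2 ⟨Module.End.mem_eigenspace_iff.2 (by simpa using hx), h0⟩)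

open Classical in
theorem posSemidef_Theta_sub {V : Type*} [Fintype V] [Nonempty V] (G : SimpleGraph V) (α : ℝ) :
    (Theta G α • (1 : Matrix V V ℝ) - generalMatrix G α).PosSemidef := by
  have hH : (Theta G α • (1 : Matrix V V ℝ) - generalMatrix G α).IsHermitian := by
    refine Matrix.IsHermitian.sub ?_ (generalMatrix_isHermitian G α)
    rw [Matrix.IsHermitian, Matrix.conjTranspose_eq_transpose_of_trivial]
    simp
  rw [hH.posSemidef_iff_eigenvalues_nonneg]
  intro i
  have h1 : Module.End.HasEigenvalue
      (Matrix.toLin' (Theta G α • (1 : Matrix V V ℝ) - generalMatrix G α)) (hH.eigenvalues i) := by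
    rw [Module.End.hasEigenvalue_iff_mem_spectrum, Matrix.spectrum_toLin',
      hH.spectrum_real_eq_range_eigenvalues]
    exact ⟨i, rfl⟩
  obtain ⟨x, hx0, hx⟩ := (hasEigenvalue_iff _ _).1 h1
  have h2 : (generalMatrix G α).mulVec x = (Theta G α - hH.eigenvalues i) • x := by
    rw [Matrix.sub_mulVec, Matrix.smul_mulVec, Matrix.one_mulVec] at hx
    rw [sub_smul, ← hx]; abel
  have := (isGreatest_Theta G α).2 ((hasEigenvalue_iff _ _).2 ⟨x, hx0, h2⟩)
  simp only [Pi.zero_apply]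
  linarith

open Classical in
theorem dotProduct_le_Theta {V : Type*} [Fintype V] [Nonempty V] (G : SimpleGraph V) (α : ℝ)
    (x : V → ℝ) : x ⬝ᵥ (generalMatrix G α).mulVec x ≤ Theta G α * (x ⬝ᵥ x) := by
  have h := (posSemidef_Theta_sub G α).dotProduct_mulVec_nonneg x
  rw [Matrix.sub_mulVec, Matrix.smul_mulVec, Matrix.one_mulVec, dotProduct_sub, dotProduct_smul] at h
  simp only [star_trivial, smul_eq_mul] at h
  linarith

-- The matrix Θ·I − M is positive semidefinite, and a vector at which a semidefinite form vanishes
-- lies in the kernel.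
open Classical in
theorem mulVec_eq_of_Theta_le {V : Type*} [Fintype V] [Nonempty V] (G : SimpleGraph V) (α : ℝ)
    (x : V → ℝ) (hx : Theta G α * (x ⬝ᵥ x) ≤ x ⬝ᵥ (generalMatrix G α).mulVec x) :
    (generalMatrix G α).mulVec x = Theta G α • x := by
  have h := (posSemidef_Theta_sub G α).dotProduct_mulVec_zero_iff x
  have h0 := dotProduct_le_Theta G α x
  rw [Matrix.sub_mulVec, Matrix.smul_mulVec, Matrix.one_mulVec, dotProduct_sub, dotProduct_smul] at h
  simp only [star_trivial, smul_eq_mul] at h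
  have := h.1 (by linarith)
  exact (sub_eq_zero.1 this).symm

/-- A connected graph has a positive eigenvector for its general spectral radius. -/
theorem exists_pos_eigenvector {V : Type*} [Fintype V] (G : SimpleGraph V) (hG : G.Connected)
    (α : ℝ) : ∃ x : V → ℝ, (∀ v, 0 < x v) ∧ (generalMatrix G α).mulVec x = Theta G α • x := by
  classical
  have := hG.nonempty
  obtain ⟨x, hx0, hx⟩ := (hasEigenvalue_iff _ _).1 (isGreatest_Theta G α).1
  set y : V → ℝ := fun v => |x v| with hy
  -- Taking absolute values leaves the diagonal terms alone and cannot decrease the products over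
  -- edges, so y also attains the maximal Rayleigh quotient.
  have hxy : x ⬝ᵥ (generalMatrix G α).mulVec x ≤ y ⬝ᵥ (generalMatrix G α).mulVec y := by
    unfold dotProduct
    refine Finset.sum_le_sum fun v _ => ?_
    rw [generalMatrix_mulVec, generalMatrix_mulVec, Finset.mul_sum, Finset.mul_sum]
    refine Finset.sum_le_sum fun w _ => ?_
    split_ifs
    · have h1 : x v * x w ≤ |x v| * |x w| := by rw [← abs_mul]; exact le_abs_self _
      have h2 : |x v| * |x v| = x v * x v := abs_mul_abs_self _
      simp only [hy]
      calc x v * (x w + α * x v) = x v * x w + α * (x v * x v) := by ring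
        _ ≤ |x v| * |x w| + α * (|x v| * |x v|) := by rw [h2]; linarith
        _ = _ := by ring
    · simp
  have hyy : y ⬝ᵥ y = x ⬝ᵥ x := by
    unfold dotProduct
    exact Finset.sum_congr rfl fun v _ => abs_mul_abs_self _
  have hy1 : (generalMatrix G α).mulVec y = Theta G α • y := by
    refine mulVec_eq_of_Theta_le G α y ?_
    rw [hyy]
    refine le_trans (le_of_eq ?_) hxy
    rw [hx, dotProduct_smul, smul_eq_mul]
  -- At a zero of y the eigenvalue equation says that a sum of nonnegative entries vanishes; zeros
  -- therefore spread along edges to the whole connected graph.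
  have key : ∀ v w, G.Adj v w → y v = 0 → y w = 0 := by
    intro v w hvw hv
    have h1 := congrFun hy1 v
    rw [generalMatrix_mulVec] at h1
    simp only [Pi.smul_apply, hv, smul_eq_mul, mul_zero, add_zero] at h1
    have h2 := (Finset.sum_eq_zero_iff_of_nonneg (fun i _ => by
      split_ifs
      · exact abs_nonneg _
      · exact le_rfl)).1 h1 w (Finset.mem_univ _)
    rwa [if_pos hvw] at h2
  refine ⟨y, fun v => ?_, hy1⟩
  refine lt_of_le_of_ne (abs_nonneg _) fun h0 => hx0 ?_
  funext w
  obtain ⟨p⟩ := hG.preconnected v w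
  have : y w = 0 := by
    have h0' : y v = 0 := h0.symm
    clear h0
    induction p with
    | nil => exact h0'
    | cons h p ih => exact ih (key _ _ h h0')
  exact abs_eq_zero.1 this

-- If the two values of `Theta` were equal, x would maximize the Rayleigh quotient of both graphs,
-- hence be an eigenvector of both matrices for the same eigenvalue, and the two images would agree.
-- Thus a weak increase of the form suffices for a strict conclusion.
open Classical in
theorem Theta_lt_of_vector {V : Type*} [Fintype V] [Nonempty V] (G G' : SimpleGraph V) (α : ℝ)
    (x : V → ℝ) (hx : ∀ v, 0 < x v) (he : (generalMatrix G α).mulVec x = Theta G α • x)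
    (hq : x ⬝ᵥ (generalMatrix G α).mulVec x ≤ x ⬝ᵥ (generalMatrix G' α).mulVec x)
    (hne : (generalMatrix G α).mulVec x ≠ (generalMatrix G' α).mulVec x) :
    Theta G α < Theta G' α := by
  have hpos : 0 < x ⬝ᵥ x := by
    unfold dotProduct
    exact Finset.sum_pos (fun v _ => mul_pos (hx v) (hx v)) Finset.univ_nonempty
  have h1 : x ⬝ᵥ (generalMatrix G α).mulVec x = Theta G α * (x ⬝ᵥ x) := by
    rw [he, dotProduct_smul, smul_eq_mul]
  have h2 := dotProduct_le_Theta G' α x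
  have h3 : Theta G α ≤ Theta G' α := by
    have : Theta G α * (x ⬝ᵥ x) ≤ Theta G' α * (x ⬝ᵥ x) := by linarith
    exact le_of_mul_le_mul_right this hpos
  refine lt_of_le_of_ne h3 fun h => hne ?_
  have h4 := mulVec_eq_of_Theta_le G' α x (by rw [← h]; linarith)
  rw [he, h4, h]

theorem Theta_eq_of_iso {V W : Type*} [Fintype V] [Fintype W] {G : SimpleGraph V}
    {H : SimpleGraph W} (e : G ≃g H) (α : ℝ) : Theta G α = Theta H α := by
  classical
  have key : ∀ (x : W → ℝ) (v : V), (generalMatrix G α).mulVec (fun v => x (e v)) v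
      = (generalMatrix H α).mulVec x (e v) := by
    intro x v
    rw [generalMatrix_mulVec, generalMatrix_mulVec]
    refine Fintype.sum_equiv e.toEquiv _ _ fun w => ?_
    have : H.Adj (e v) (e w) ↔ G.Adj v w := e.map_adj_iff
    simp [this]
  unfold Theta
  congr 1
  ext μ
  simp only [Set.mem_ofPred_eq]
  rw [hasEigenvalue_iff, hasEigenvalue_iff]
  constructor
  · rintro ⟨x, hx0, hx⟩
    refine ⟨fun w => x (e.symm w), fun h => hx0 ?_, ?_⟩
    · funext v
      simpa using congrFun h (e v)
    · funext w
      obtain ⟨v, rfl⟩ := e.surjective w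
      rw [← key]
      simpa using congrFun hx v
  · rintro ⟨x, hx0, hx⟩
    refine ⟨fun v => x (e v), fun h => hx0 ?_, ?_⟩
    · funext w
      obtain ⟨v, rfl⟩ := e.surjective w
      simpa using congrFun h v
    · funext v
      rw [key, hx]
      simp

/-! ### Moving one end of an edge -/

section Slide

open scoped Classical

variable {W : Type*}

/-- The graph obtained from `H` by replacing the edge `vw` by the edge `uw`. -/
def slide (H : SimpleGraph W) (w v u : W) : SimpleGraph W :=
  H.deleteEdges {s(v, w)} ⊔ SimpleGraph.edge u w

theorem slide_adj {H : SimpleGraph W} {w v u : W} (huw : u ≠ w) (a b : W) :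
    (slide H w v u).Adj a b ↔
      (H.Adj a b ∧ ¬ (a = v ∧ b = w) ∧ ¬ (a = w ∧ b = v)) ∨
        (a = u ∧ b = w) ∨ (a = w ∧ b = u) := by
  simp only [slide, SimpleGraph.sup_adj, SimpleGraph.deleteEdges_adj, SimpleGraph.edge_adj,
    Set.mem_singleton_iff, Sym2.eq_iff]
  grind

theorem connected_of_adj_reachable {H H' : SimpleGraph W} (hH : H.Connected)
    (h : ∀ a b, H.Adj a b → H'.Reachable a b) : H'.Connected := by
  have := hH.nonempty
  refine ⟨fun a b => ?_⟩
  obtain ⟨p⟩ := hH.preconnected a b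
  induction p with
  | nil => exact SimpleGraph.Reachable.refl _
  | cons hab p ih => exact (h _ _ hab).trans ih

/-- Every other edge survives, so only the ends of the removed edge have to be joined again. -/
theorem slide_connected {H : SimpleGraph W} {w v u : W} (hH : H.Connected) (huw : u ≠ w)
    (hr : (slide H w v u).Reachable v w) : (slide H w v u).Connected := by
  refine connected_of_adj_reachable hH fun a b hab => ?_
  by_cases h1 : a = v ∧ b = w
  · rw [h1.1, h1.2]; exact hr
  by_cases h2 : a = w ∧ b = v
  · rw [h2.1, h2.2]; exact hr.symm
  exact ((slide_adj huw a b).2 (Or.inl ⟨hab, h1, h2⟩)).reachable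

/-- Every vertex other than `x` that is not farther from `r` than `x` can be reached from `r`
without using an edge at `x`. -/
theorem reachable_of_dist_le {H H' : SimpleGraph W} (hH : H.Connected) (r x : W)
    (h : ∀ a b, H.Adj a b → a ≠ x → b ≠ x → H'.Adj a b) (z : W) (hz : z ≠ x)
    (hd : H.dist r z ≤ H.dist r x) : H'.Reachable r z := by
  induction hk : H.dist r z using Nat.strong_induction_on generalizing z with
  | _ k ih =>
    obtain ⟨p, hp⟩ := (hH.preconnected z r).exists_walk_length_eq_dist
    cases p with
    | nil => exact SimpleGraph.Reachable.refl _
    | @cons _ y _ hzy p =>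
      have h1 : H.dist y r ≤ p.length := SimpleGraph.dist_le p
      rw [SimpleGraph.Walk.length_cons] at hp
      rw [SimpleGraph.dist_comm (u := z)] at hp
      rw [SimpleGraph.dist_comm] at h1
      have hyx : y ≠ x := by rintro rfl; omega
      exact (ih _ (by omega) y hyx (by omega) rfl).trans (h _ _ hzy.symm hyx hz).reachable

theorem exists_adj_dist_lt {H : SimpleGraph W} (hH : H.Connected) {u v : W} (huv : u ≠ v) :
    ∃ s, H.Adj v s ∧ H.dist u s < H.dist u v := by
  obtain ⟨p, hp⟩ := (hH.preconnected v u).exists_walk_length_eq_dist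
  cases p with
  | nil => exact absurd rfl huv
  | @cons _ y _ hzy p =>
    have h1 : H.dist y u ≤ p.length := SimpleGraph.dist_le p
    rw [SimpleGraph.Walk.length_cons, SimpleGraph.dist_comm] at hp
    rw [SimpleGraph.dist_comm] at h1
    exact ⟨y, hzy, by omega⟩

/-- Retracting the leaf y onto its only neighbour x carries walks of H to walks that avoid the
removed edge; y then hangs from v. -/
theorem slide_leaf_connected {H : SimpleGraph W} {x y v : W} (hH : H.Connected) (hxy : H.Adj x y)
    (hy : ∀ z, H.Adj y z → z = x) (hvy : v ≠ y) : (slide H y x v).Connected := by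
  have key : ∀ a b, H.Reachable a b → b ≠ y →
      (slide H y x v).Reachable (if a = y then x else a) b := by
    rintro a b ⟨p⟩ hb
    induction p with
    | nil => rw [if_neg hb]
    | @cons a c b hac p ih =>
      have ih := ih hb
      by_cases ha : a = y
      · subst ha
        have hcx := hy c hac
        subst hcx
        rw [if_neg hac.ne'] at ih
        rw [if_pos rfl]
        exact ih
      · rw [if_neg ha]
        by_cases hc : c = y
        · subst hc
          rw [if_pos rfl] at ih
          rwa [hy a hac.symm]
        · rw [if_neg hc] at ih
          exact ((slide_adj hvy _ _).2
            (Or.inl ⟨hac, fun h => hc h.2, fun h => ha h.1⟩)).reachable.trans ih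
  refine slide_connected hH hvy ?_
  have h1 := key x v (hH.preconnected x v) hvy
  rw [if_neg hxy.ne] at h1
  exact h1.trans ((slide_adj hvy v y).2 (Or.inr (Or.inl ⟨rfl, rfl⟩))).reachable

/-- Two edges from `v` to vertices equal or adjacent to `u` lie on a common cycle. -/
theorem reachable_deleteEdges_of_shared {H : SimpleGraph W} {u v w w' : W} (huv : u ≠ v)
    (hww : w ≠ w') (hvw : H.Adj v w) (hvw' : H.Adj v w') (hw : w = u ∨ H.Adj u w)
    (hw' : w' = u ∨ H.Adj u w') : (H.deleteEdges {s(v, w)}).Reachable v w := by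
  have n1 := hvw.ne; have n2 := hvw'.ne
  have h1 : (H.deleteEdges {s(v, w)}).Reachable v w' := by
    refine SimpleGraph.Adj.reachable ?_
    simp only [SimpleGraph.deleteEdges_adj, Set.mem_singleton_iff, Sym2.eq_iff]
    grind
  have h2 : ∀ z, (z = u ∨ H.Adj u z) → z ≠ v → (H.deleteEdges {s(v, w)}).Reachable u z := by
    rintro z (rfl | hz) hzv
    · exact SimpleGraph.Reachable.refl _
    · refine SimpleGraph.Adj.reachable ?_
      simp only [SimpleGraph.deleteEdges_adj, Set.mem_singleton_iff, Sym2.eq_iff]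
      grind
  exact h1.trans ((h2 w' hw' n2.symm).symm.trans (h2 w hw n1.symm))

variable [Fintype W]

theorem sum_slide {H : SimpleGraph W} {w v u : W} (hvw : H.Adj v w) (huw : ¬ H.Adj u w)
    (hne : u ≠ w) (huv : u ≠ v) (g : W → W → ℝ) (z : W) :
    (∑ y, if (slide H w v u).Adj z y then g z y else 0) =
      (∑ y, if H.Adj z y then g z y else 0) + (if z = u then g u w else 0)
        + (if z = w then g w u else 0) - (if z = v then g v w else 0)
        - (if z = w then g w v else 0) := by
  have hs : ∀ a b : W, (if z = a then g a b else 0)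
      = ∑ y, if z = a ∧ y = b then g a b else 0 := by
    intro a b
    by_cases h : z = a <;> simp [h]
  rw [hs u w, hs w u, hs v w, hs w v, ← Finset.sum_add_distrib, ← Finset.sum_add_distrib,
    ← Finset.sum_sub_distrib, ← Finset.sum_sub_distrib]
  refine Finset.sum_congr rfl fun y _ => ?_
  have hvw' := hvw.symm
  have hwu' : ¬ H.Adj w u := fun h => huw h.symm
  have hne' := hvw.ne
  simp only [slide_adj hne]
  by_cases h1 : z = u ∧ y = w
  · obtain ⟨rfl, rfl⟩ := h1
    simp [huw, hne, huv]
  by_cases h2 : z = w ∧ y = u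
  · obtain ⟨rfl, rfl⟩ := h2
    simp [hwu', hne.symm, huv, hne]
  by_cases h3 : z = v ∧ y = w
  · obtain ⟨rfl, rfl⟩ := h3
    simp [hvw, hne', huv.symm, hne.symm]
  by_cases h4 : z = w ∧ y = v
  · obtain ⟨rfl, rfl⟩ := h4
    simp [hvw', hne'.symm, huv.symm, hne.symm]
  simp [h1, h2, h3, h4]

/-- The value at `z` of the general matrix of `H` applied to `f`. -/
noncomputable def act (α : ℝ) (f : W → ℝ) (H : SimpleGraph W) (z : W) : ℝ :=
  ∑ y, if H.Adj z y then f y + α * f z else 0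

/-- The quadratic form of the general matrix of `H` at `f`. -/
noncomputable def quad (α : ℝ) (f : W → ℝ) (H : SimpleGraph W) : ℝ :=
  ∑ z, f z * act α f H z

theorem degree_eq_sum (H : SimpleGraph W) (z : W) :
    ((H.degree z : ℕ) : ℝ) = ∑ y, if H.Adj z y then (1 : ℝ) else 0 := by
  rw [← SimpleGraph.card_neighborFinset_eq_degree, SimpleGraph.neighborFinset_eq_filter]
  simp

theorem act_slide {H : SimpleGraph W} {w v u : W} (hvw : H.Adj v w) (huw : ¬ H.Adj u w)
    (hne : u ≠ w) (huv : u ≠ v) (α : ℝ) (f : W → ℝ) (z : W) :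
    act α f (slide H w v u) z = act α f H z + (if z = u then f w + α * f u else 0)
        + (if z = w then f u - f v else 0) - (if z = v then f w + α * f v else 0) := by
  unfold act
  rw [sum_slide hvw huw hne huv (fun a b => f b + α * f a) z]
  split_ifs <;> ring

/-- For α ≥ 0 and positive f, both added terms are nonnegative as soon as f v ≤ f u. -/
theorem quad_slide {H : SimpleGraph W} {w v u : W} (hvw : H.Adj v w) (huw : ¬ H.Adj u w)
    (hne : u ≠ w) (huv : u ≠ v) (α : ℝ) (f : W → ℝ) :
    quad α f (slide H w v u) = quad α f H + 2 * f w * (f u - f v)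
      + α * (f u * f u - f v * f v) := by
  unfold quad
  simp only [act_slide hvw huw hne huv, mul_add, mul_sub, Finset.sum_add_distrib,
    Finset.sum_sub_distrib, mul_ite, mul_zero, Finset.sum_ite_eq', Finset.mem_univ, if_true]
  ring

theorem degree_slide {H : SimpleGraph W} {w v u : W} (hvw : H.Adj v w) (huw : ¬ H.Adj u w)
    (hne : u ≠ w) (huv : u ≠ v) (z : W) :
    (slide H w v u).degree z + (if z = v then 1 else 0)
      = H.degree z + (if z = u then 1 else 0) := by
  have h : (((slide H w v u).degree z + (if z = v then 1 else 0) : ℕ) : ℝ)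
      = ((H.degree z + (if z = u then 1 else 0) : ℕ) : ℝ) := by
    push_cast
    rw [degree_eq_sum, degree_eq_sum, sum_slide hvw huw hne huv (fun _ _ => 1) z]
    split_ifs <;> ring
  exact_mod_cast h

/-- The neighbours of `v` that are equal or adjacent to `u`. -/
noncomputable def shared (H : SimpleGraph W) (u v : W) : Finset W :=
  Finset.univ.filter fun w => H.Adj v w ∧ (w = u ∨ H.Adj u w)

theorem mem_shared {H : SimpleGraph W} {u v w : W} :
    w ∈ shared H u v ↔ H.Adj v w ∧ (w = u ∨ H.Adj u w) := by
  simp [shared]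

theorem shared_subset (H : SimpleGraph W) (u v : W) :
    shared H u v ⊆ H.neighborFinset v := fun w hw => by
  rw [SimpleGraph.mem_neighborFinset]; exact (mem_shared.1 hw).1

/-- Common neighbours are kept, and u as a neighbour of v is exchanged for v as a neighbour of u. -/
theorem card_shared_le_comm (H : SimpleGraph W) (u v : W) (huv : u ≠ v) :
    (shared H u v).card ≤ (shared H v u).card := by
  refine Finset.card_le_card_of_injOn (fun w => if w = u then v else w) ?_ ?_
  · intro w hw
    simp only [Finset.mem_coe, mem_shared] at hw ⊢
    by_cases h : w = u
    · subst h; simp [hw.1.symm]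
    · simp only [h, if_false]
      exact ⟨hw.2.resolve_left h, Or.inr hw.1⟩
  · intro a ha b hb hab
    simp only [Finset.mem_coe, mem_shared] at ha hb
    have h1 := ha.1.ne
    have h2 := hb.1.ne
    simp only at hab
    grind

theorem card_shared_comm (H : SimpleGraph W) (u v : W) (huv : u ≠ v) :
    (shared H u v).card = (shared H v u).card :=
  le_antisymm (card_shared_le_comm H u v huv) (card_shared_le_comm H v u huv.symm)

/-- A neighbour of `v` can be moved to `u` keeping the graph connected. -/
theorem exists_slide {H : SimpleGraph W} (hH : H.Connected) {u v : W} (huv : u ≠ v)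
    (hc : 1 + max 1 (shared H u v).card ≤ H.degree v) :
    ∃ w, H.Adj v w ∧ ¬ H.Adj u w ∧ u ≠ w ∧ (slide H w v u).Connected := by
  obtain ⟨s, hvs, hs⟩ := exists_adj_dist_lt hH huv
  -- The vertex s, a neighbour of v closer to u, must stay attached to keep v linked to u. It costs
  -- nothing extra when some neighbour is shared, since dist u v ≤ 2 then makes s shared as well;
  -- this is why the bound involves `max 1`.
  have hcard : (insert s (shared H u v)).card < (H.neighborFinset v).card := by
    rw [SimpleGraph.card_neighborFinset_eq_degree]
    rcases (shared H u v).eq_empty_or_nonempty with h0 | ⟨c, hc'⟩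
    · rw [h0] at hc ⊢
      simp at hc ⊢
      omega
    · have hsm : s ∈ shared H u v := by
        rw [mem_shared] at hc' ⊢
        refine ⟨hvs, ?_⟩
        have h2 : H.dist u v ≤ 2 := by
          rcases hc'.2 with rfl | h
          · have := SimpleGraph.dist_eq_one_iff_adj.2 hc'.1.symm
            omega
          · have h3 := hH.dist_triangle (u := u) (v := c) (w := v)
            have h4 := SimpleGraph.dist_eq_one_iff_adj.2 h
            have h5 := SimpleGraph.dist_eq_one_iff_adj.2 hc'.1.symm
            omega
        rcases Nat.lt_or_ge 0 (H.dist u s) with h | h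
        · right
          exact SimpleGraph.dist_eq_one_iff_adj.1 (by omega)
        · left
          exact ((hH.dist_eq_zero_iff).1 (by omega)).symm
      rw [Finset.insert_eq_of_mem hsm]
      omega
  obtain ⟨w, hw, hw'⟩ := Finset.exists_mem_notMem_of_card_lt_card hcard
  rw [SimpleGraph.mem_neighborFinset] at hw
  rw [Finset.mem_insert, mem_shared] at hw'
  push Not at hw'
  obtain ⟨hws, hw2⟩ := hw'
  obtain ⟨hwu, hadj⟩ := hw2 hw
  refine ⟨w, hw, hadj, hwu.symm, slide_connected hH hwu.symm ?_⟩
  -- The ends of the removed edge are rejoined along v, s, a geodesic from s to u that avoids v, and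
  -- the new edge uw.
  have h1 : (slide H w v u).Adj v s :=
    (slide_adj hwu.symm _ _).2 (Or.inl ⟨hvs, fun h => hws h.2.symm, fun h => hw.ne h.1⟩)
  have h2 : (slide H w v u).Reachable u s := by
    refine reachable_of_dist_le hH u v (fun a b hab ha hb => ?_) s hvs.ne' hs.le
    exact (slide_adj hwu.symm _ _).2 (Or.inl ⟨hab, fun h => ha h.1, fun h => hb h.2⟩)
  have h3 : (slide H w v u).Adj u w := (slide_adj hwu.symm _ _).2 (Or.inr (Or.inl ⟨rfl, rfl⟩))
  exact h1.reachable.trans (h2.symm.trans h3.reachable)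

/-- The moved vertex w is not shared before the move and is no longer a neighbour of v afterwards.
The obstruction therefore does not grow, and moves can be iterated. -/
theorem shared_slide {H : SimpleGraph W} {w v u : W} (hvw : H.Adj v w) (huw : ¬ H.Adj u w)
    (hne : u ≠ w) (huv : u ≠ v) : shared (slide H w v u) u v = shared H u v := by
  ext z
  have := hvw.ne
  simp only [mem_shared, slide_adj hne]
  grind

/-- Moving `k` neighbours of `v` to `u`. -/
theorem exists_shift {α : ℝ} (hα : 0 ≤ α) {f : W → ℝ} (hf : ∀ z, 0 < f z) {u v : W}
    (huv : u ≠ v) (hfuv : f v ≤ f u) (k : ℕ) : ∀ H : SimpleGraph W, H.Connected →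
      k + max 1 (shared H u v).card ≤ H.degree v →
      ∃ H' : SimpleGraph W, H'.Connected ∧
        (∀ z, H'.degree z + (if z = v then k else 0) = H.degree z + (if z = u then k else 0)) ∧
        quad α f H ≤ quad α f H' ∧ act α f H u ≤ act α f H' u ∧
        (0 < k → act α f H u < act α f H' u) := by
  induction k with
  | zero => exact fun H hH _ => ⟨H, hH, by simp, le_rfl, le_rfl, by simp⟩
  | succ k ih =>
    intro H hH hc
    obtain ⟨w, hvw, huw, hne, hconn⟩ := exists_slide hH huv (by omega)
    have hd := degree_slide hvw huw hne huv
    have hdv := hd v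
    rw [if_pos rfl, if_neg huv.symm] at hdv
    obtain ⟨H', h1, h2, h3, h4, -⟩ := ih (slide H w v u) hconn (by
      rw [shared_slide hvw huw hne huv]; omega)
    have hq := quad_slide hvw huw hne huv α f
    have ha := act_slide hvw huw hne huv α f u
    rw [if_pos rfl, if_neg hne, if_neg huv] at ha
    have hp : 0 < f w + α * f u := add_pos_of_pos_of_nonneg (hf w) (mul_nonneg hα (hf u).le)
    have hq1 : 0 ≤ 2 * f w * (f u - f v) :=
      mul_nonneg (by have := hf w; linarith) (by linarith)
    have hq2 : 0 ≤ α * (f u * f u - f v * f v) :=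
      mul_nonneg hα (by have := mul_self_le_mul_self (hf v).le hfuv; linarith)
    refine ⟨H', h1, fun z => ?_, by linarith, by linarith, fun _ => by linarith⟩
    have e1 := h2 z
    have e2 := hd z
    split_ifs at * <;> omega

end Slide

/-! ### Cycles in unicyclic graphs -/

section Unicyclic

open scoped Classical

variable {W : Type*} [Fintype W]

/-- By the handshake identity, a modification that keeps the degree sum only has to be checked for
connectedness. -/
theorem isCyclic_one_iff {H : SimpleGraph W} :
    IsCyclic 1 H ↔ H.Connected ∧ ∑ z, H.degree z = 2 * Fintype.card W := by
  unfold IsCyclic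
  rw [H.sum_degrees_eq_twice_card_edges, ← Set.ncard_coe_finset, SimpleGraph.coe_edgeFinset]
  refine and_congr_right fun _ => ?_
  omega

/-- A connected graph on |W| vertices has at least |W| − 1 edges, while H has only |W|. This is the
form in which the uniqueness of the cycle is used. -/
theorem not_connected_of_two_missing {H H' : SimpleGraph W} (hH : IsCyclic 1 H) (hle : H' ≤ H)
    {e₁ e₂ : Sym2 W} (h₁ : e₁ ∈ H.edgeSet) (h₂ : e₂ ∈ H.edgeSet) (hne : e₁ ≠ e₂)
    (h₁' : e₁ ∉ H'.edgeSet) (h₂' : e₂ ∉ H'.edgeSet) : ¬ H'.Connected := by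
  intro hc
  have h := hc.card_vert_le_card_edgeSet_add_one
  have hsub : H'.edgeSet ⊆ H.edgeSet \ {e₁, e₂} := by
    intro e he
    refine ⟨SimpleGraph.edgeSet_mono hle he, ?_⟩
    rintro (rfl | rfl)
    · exact h₁' he
    · exact h₂' he
  have h3 := Set.ncard_le_ncard hsub (Set.toFinite _)
  have h4 : ({e₁, e₂} : Set (Sym2 W)) ⊆ H.edgeSet := by
    rintro e (rfl | rfl) <;> assumption
  rw [Set.ncard_sdiff h4, Set.ncard_pair hne] at h3
  have h5 := Set.ncard_le_ncard h4 (Set.toFinite _)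
  rw [Set.ncard_pair hne] at h5
  have h6 := hH.2
  rw [Nat.card_coe_set_eq, Nat.card_eq_fintype_card] at h
  omega

theorem not_adj_of_two_common {H : SimpleGraph W} (hH : IsCyclic 1 H) {u v a b : W}
    (hab : a ≠ b) (hua : H.Adj u a) (hub : H.Adj u b) (hva : H.Adj v a) (hvb : H.Adj v b)
    (huv : H.Adj u v) : False := by
  have hne : s(u, a) ≠ s(u, b) := by
    have := hua.ne; have := hub.ne
    simp only [ne_eq, Sym2.eq_iff]; grind
  refine not_connected_of_two_missing (H' := H.deleteEdges {s(u, a), s(u, b)}) hH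
    (SimpleGraph.deleteEdges_le _) (e₁ := s(u, a)) (e₂ := s(u, b)) hua hub hne
    (by simp) (by simp) ?_
  have n1 := hua.ne; have n2 := hub.ne; have n3 := hva.ne; have n4 := hvb.ne; have n5 := huv.ne
  have huv' : (H.deleteEdges {s(u, a), s(u, b)}).Adj u v := by
    simp only [SimpleGraph.deleteEdges_adj, Set.mem_insert_iff, Set.mem_singleton_iff, Sym2.eq_iff]
    grind
  have hva' : (H.deleteEdges {s(u, a), s(u, b)}).Adj v a := by
    simp only [SimpleGraph.deleteEdges_adj, Set.mem_insert_iff, Set.mem_singleton_iff, Sym2.eq_iff]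
    grind
  have hvb' : (H.deleteEdges {s(u, a), s(u, b)}).Adj v b := by
    simp only [SimpleGraph.deleteEdges_adj, Set.mem_insert_iff, Set.mem_singleton_iff, Sym2.eq_iff]
    grind
  have ra := huv'.reachable.trans hva'.reachable
  have rb := huv'.reachable.trans hvb'.reachable
  refine connected_of_adj_reachable hH.1 fun x y hxy => ?_
  by_cases h : s(x, y) = s(u, a) ∨ s(x, y) = s(u, b)
  · simp only [Sym2.eq_iff] at h
    rcases h with (⟨rfl, rfl⟩ | ⟨rfl, rfl⟩) | (⟨rfl, rfl⟩ | ⟨rfl, rfl⟩)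
    exacts [ra, ra.symm, rb, rb.symm]
  · refine SimpleGraph.Adj.reachable ?_
    rw [SimpleGraph.deleteEdges_adj]
    exact ⟨hxy, h⟩

theorem not_three_common {H : SimpleGraph W} (hH : IsCyclic 1 H) {u v a b c : W} (huv : u ≠ v)
    (hab : a ≠ b) (hac : a ≠ c) (hbc : b ≠ c) (hua : H.Adj u a) (hub : H.Adj u b)
    (huc : H.Adj u c) (hva : H.Adj v a) (hvb : H.Adj v b) (hvc : H.Adj v c) : False := by
  have hne : s(u, a) ≠ s(u, b) := by
    have := hua.ne; have := hub.ne
    simp only [ne_eq, Sym2.eq_iff]; grind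
  refine not_connected_of_two_missing (H' := H.deleteEdges {s(u, a), s(u, b)}) hH
    (SimpleGraph.deleteEdges_le _) (e₁ := s(u, a)) (e₂ := s(u, b)) hua hub hne
    (by simp) (by simp) ?_
  have n1 := hua.ne; have n2 := hub.ne; have n3 := hva.ne; have n4 := hvb.ne; have n5 := huc.ne
  have huc' : (H.deleteEdges {s(u, a), s(u, b)}).Adj u c := by
    simp only [SimpleGraph.deleteEdges_adj, Set.mem_insert_iff, Set.mem_singleton_iff, Sym2.eq_iff]
    grind
  have hvc' : (H.deleteEdges {s(u, a), s(u, b)}).Adj v c := by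
    simp only [SimpleGraph.deleteEdges_adj, Set.mem_insert_iff, Set.mem_singleton_iff, Sym2.eq_iff]
    grind
  have hva' : (H.deleteEdges {s(u, a), s(u, b)}).Adj v a := by
    simp only [SimpleGraph.deleteEdges_adj, Set.mem_insert_iff, Set.mem_singleton_iff, Sym2.eq_iff]
    grind
  have hvb' : (H.deleteEdges {s(u, a), s(u, b)}).Adj v b := by
    simp only [SimpleGraph.deleteEdges_adj, Set.mem_insert_iff, Set.mem_singleton_iff, Sym2.eq_iff]
    grind
  have r := huc'.reachable.trans hvc'.reachable.symm
  have ra := r.trans hva'.reachable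
  have rb := r.trans hvb'.reachable
  refine connected_of_adj_reachable hH.1 fun x y hxy => ?_
  by_cases h : s(x, y) = s(u, a) ∨ s(x, y) = s(u, b)
  · simp only [Sym2.eq_iff] at h
    rcases h with (⟨rfl, rfl⟩ | ⟨rfl, rfl⟩) | (⟨rfl, rfl⟩ | ⟨rfl, rfl⟩)
    exacts [ra, ra.symm, rb, rb.symm]
  · refine SimpleGraph.Adj.reachable ?_
    rw [SimpleGraph.deleteEdges_adj]
    exact ⟨hxy, h⟩

/-- Three shared neighbours would give two independent cycles: an edge uv with two common neighbours
if one of the three is u, and three common neighbours otherwise. -/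
theorem card_shared_le_two {H : SimpleGraph W} (hH : IsCyclic 1 H) {u v : W} (huv : u ≠ v) :
    (shared H u v).card ≤ 2 := by
  by_contra hlt
  obtain ⟨a, ha, b, hb, c, hc, hab, hac, hbc⟩ := Finset.two_lt_card.1 (not_le.1 hlt)
  rw [mem_shared] at ha hb hc
  rcases ha with ⟨ha, rfl | ha'⟩
  · exact not_adj_of_two_common hH hbc (hb.2.resolve_left hab.symm) (hc.2.resolve_left hac.symm)
      hb.1 hc.1 ha.symm
  rcases hb with ⟨hb, rfl | hb'⟩
  · exact not_adj_of_two_common hH hac ha' (hc.2.resolve_left hbc.symm) ha hc.1 hb.symm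
  rcases hc with ⟨hc, rfl | hc'⟩
  · exact not_adj_of_two_common hH hab ha' hb' ha hb hc.symm
  exact not_three_common hH huv hab hac hbc ha' hb' hc' ha hb hc

theorem exists_two_neighbors {H : SimpleGraph W} {x : W} (hx : 2 ≤ H.degree x) :
    ∃ y₁ y₂, y₁ ≠ y₂ ∧ H.Adj x y₁ ∧ H.Adj x y₂ := by
  rw [← SimpleGraph.card_neighborFinset_eq_degree] at hx
  obtain ⟨a, ha, b, hb, hab⟩ := Finset.one_lt_card.1 hx
  rw [SimpleGraph.mem_neighborFinset] at ha hb
  exact ⟨a, b, hab, ha, hb⟩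

theorem two_le_degree {H : SimpleGraph W} {x y₁ y₂ : W} (h : y₁ ≠ y₂) (h₁ : H.Adj x y₁)
    (h₂ : H.Adj x y₂) : 2 ≤ H.degree x := by
  rw [← SimpleGraph.card_neighborFinset_eq_degree]
  exact Finset.one_lt_card.2 ⟨y₁, by simpa using h₁, y₂, by simpa using h₂, h⟩

/-- In a unicyclic graph, if some vertex off the short cycle through `v` is not a leaf, then some
such vertex has a leaf neighbour. -/
theorem exists_adj_leaf {H : SimpleGraph W} (hH : IsCyclic 1 H) {u v w₁ w₂ : W} (huv : u ≠ v)
    (hww : w₁ ≠ w₂) (h₁ : H.Adj v w₁) (h₂ : H.Adj v w₂)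
    (hv : ∀ z, H.Adj v z → z = w₁ ∨ z = w₂)
    (hw₁ : w₁ = u ∨ H.Adj u w₁) (hw₂ : w₂ = u ∨ H.Adj u w₂)
    {z₀ : W} (hz₀ : 2 ≤ H.degree z₀) (hzu : z₀ ≠ u) (hzv : z₀ ≠ v) (hz₁ : z₀ ≠ w₁)
    (hz₂ : z₀ ≠ w₂) :
    ∃ x y, x ≠ u ∧ x ≠ v ∧ x ≠ w₁ ∧ x ≠ w₂ ∧ 2 ≤ H.degree x ∧ H.Adj x y ∧ H.degree y = 1 := by
  -- Take x farthest from v among the non-leaves off the short cycle; a neighbour still farther from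
  -- v must be a leaf.
  obtain ⟨x, hx, hmax⟩ := Finset.exists_max_image
    (Finset.univ.filter fun x => x ≠ u ∧ x ≠ v ∧ x ≠ w₁ ∧ x ≠ w₂ ∧ 2 ≤ H.degree x)
    (fun x => H.dist v x) ⟨z₀, by simp [hz₀, hzu, hzv, hz₁, hz₂]⟩
  simp only [Finset.mem_filter, Finset.mem_univ, true_and] at hx hmax
  obtain ⟨hxu, hxv, hx₁, hx₂, hxd⟩ := hx
  have hnadj : ¬ H.Adj v x := fun h => by
    rcases hv x h with h | h
    · exact hx₁ h
    · exact hx₂ h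
  have hdx : 2 ≤ H.dist v x := by
    have h0 : H.dist v x ≠ 0 := fun h => hxv ((hH.1.dist_eq_zero_iff).1 h).symm
    have h1 : H.dist v x ≠ 1 := fun h => hnadj (SimpleGraph.dist_eq_one_iff_adj.1 h)
    omega
  have hdw₁ := SimpleGraph.dist_eq_one_iff_adj.2 h₁
  have hdw₂ := SimpleGraph.dist_eq_one_iff_adj.2 h₂
  have hdu : H.dist v u ≤ 2 := by
    rcases hw₁ with rfl | h
    · omega
    · have h3 := hH.1.dist_triangle (u := v) (v := w₁) (w := u)
      have := SimpleGraph.dist_eq_one_iff_adj.2 h.symm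
      omega
  -- Otherwise x has two neighbours reachable from v without passing x, so one edge at x can be
  -- deleted. The short cycle avoids x, so its edge `s(v, w₁)` can be deleted too without
  -- disconnecting, which is one edge too many.
  have hfar : ∃ y, H.Adj x y ∧ H.dist v x < H.dist v y := by
    by_contra hcon
    push Not at hcon
    obtain ⟨y₁, y₂, hy, hxy₁, hxy₂⟩ := exists_two_neighbors hxd
    have hc1 : (H.deleteEdges {s(x, y₁)}).Connected := by
      have hr : ∀ z, z ≠ x → H.dist v z ≤ H.dist v x →
          (H.deleteEdges {s(x, y₁)}).Reachable v z := fun z hz hd =>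
        reachable_of_dist_le hH.1 v x (fun a b hab ha hb => by
          simp only [SimpleGraph.deleteEdges_adj, Set.mem_singleton_iff, Sym2.eq_iff]
          grind) z hz hd
      have r1 := hr y₁ hxy₁.ne' (hcon y₁ hxy₁)
      have r2 := hr y₂ hxy₂.ne' (hcon y₂ hxy₂)
      have r3 : (H.deleteEdges {s(x, y₁)}).Adj x y₂ := by
        have := hxy₁.ne
        simp only [SimpleGraph.deleteEdges_adj, Set.mem_singleton_iff, Sym2.eq_iff]
        grind
      have r4 := r3.reachable.trans (r2.symm.trans r1)
      refine connected_of_adj_reachable hH.1 fun a b hab => ?_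
      by_cases h : s(a, b) = s(x, y₁)
      · rw [Sym2.eq_iff] at h
        rcases h with ⟨rfl, rfl⟩ | ⟨rfl, rfl⟩
        exacts [r4, r4.symm]
      · refine SimpleGraph.Adj.reachable ?_
        rw [SimpleGraph.deleteEdges_adj]
        exact ⟨hab, h⟩
    have hadj : ∀ a b, H.Adj a b → a ≠ x → b ≠ x → (H.deleteEdges {s(x, y₁)}).Adj a b := by
      intro a b hab ha hb
      simp only [SimpleGraph.deleteEdges_adj, Set.mem_singleton_iff, Sym2.eq_iff]
      grind
    have hr2 := reachable_deleteEdges_of_shared (H := H.deleteEdges {s(x, y₁)}) huv hww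
      (hadj _ _ h₁ hxv.symm hx₁.symm) (hadj _ _ h₂ hxv.symm hx₂.symm)
      (hw₁.imp_right fun h => hadj _ _ h hxu.symm hx₁.symm)
      (hw₂.imp_right fun h => hadj _ _ h hxu.symm hx₂.symm)
    refine not_connected_of_two_missing (e₁ := s(x, y₁)) (e₂ := s(v, w₁)) hH
      ((SimpleGraph.deleteEdges_le (G := H.deleteEdges {s(x, y₁)}) {s(v, w₁)}).trans
        (SimpleGraph.deleteEdges_le _)) hxy₁ h₁ ?_ (by simp) (by simp) ?_
    · simp only [ne_eq, Sym2.eq_iff]; grind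
    · refine connected_of_adj_reachable hc1 fun a b hab => ?_
      by_cases h : s(a, b) = s(v, w₁)
      · rw [Sym2.eq_iff] at h
        rcases h with ⟨rfl, rfl⟩ | ⟨rfl, rfl⟩
        exacts [hr2, hr2.symm]
      · refine SimpleGraph.Adj.reachable ?_
        rw [SimpleGraph.deleteEdges_adj (s := {s(v, w₁)})]
        exact ⟨hab, h⟩
  obtain ⟨y, hxy, hy⟩ := hfar
  refine ⟨x, y, hxu, hxv, hx₁, hx₂, hxd, hxy, ?_⟩
  have hpos : 0 < H.degree y := (H.degree_pos_iff_exists_adj y).2 ⟨x, hxy.symm⟩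
  by_contra hne
  have := hmax y ⟨by rintro rfl; omega, by rintro rfl; simp at hy, by rintro rfl; omega,
    by rintro rfl; omega, by omega⟩
  omega

end Unicyclic

/-! ### Maximal cones and the unit transfer -/

section Cone

open scoped Classical

variable {W : Type*}

/-- The join of `K_t` and `H`. -/
abbrev cone (t : ℕ) (H : SimpleGraph W) : SimpleGraph (Fin t ⊕ W) :=
  join (⊤ : SimpleGraph (Fin t)) H

theorem cone_adj_inl_inl {t : ℕ} {H : SimpleGraph W} (i j : Fin t) :
    (cone t H).Adj (Sum.inl i) (Sum.inl j) ↔ i ≠ j := by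
  simp [cone, join]

theorem cone_adj_inl_inr {t : ℕ} {H : SimpleGraph W} (i : Fin t) (z : W) :
    (cone t H).Adj (Sum.inl i) (Sum.inr z) := by
  simp [cone, join]

theorem cone_adj_inr_inl {t : ℕ} {H : SimpleGraph W} (i : Fin t) (z : W) :
    (cone t H).Adj (Sum.inr z) (Sum.inl i) := by
  simp [cone, join]

theorem cone_adj_inr_inr {t : ℕ} {H : SimpleGraph W} (y z : W) :
    (cone t H).Adj (Sum.inr y) (Sum.inr z) ↔ H.Adj y z := by
  simp [cone, join]

theorem cone_connected {t : ℕ} {H : SimpleGraph W} (hH : H.Connected) : (cone t H).Connected := by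
  obtain ⟨z₀⟩ := hH.nonempty
  have key : ∀ x : Fin t ⊕ W, (cone t H).Reachable x (Sum.inr z₀) := by
    rintro (i | z)
    · exact (cone_adj_inl_inr i z₀).reachable
    · obtain ⟨p⟩ := hH.preconnected z z₀
      induction p with
      | nil => exact SimpleGraph.Reachable.refl _
      | cons h p ih => exact ((cone_adj_inr_inr _ _).2 h).reachable.trans ih
  have : Nonempty (Fin t ⊕ W) := ⟨Sum.inr z₀⟩
  exact ⟨fun x y => (key x).trans (key y).symm⟩

variable [Fintype W]

theorem cone_mulVec_inl {t : ℕ} (H H' : SimpleGraph W) (α : ℝ) (x : Fin t ⊕ W → ℝ) (i : Fin t) :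
    (generalMatrix (cone t H') α).mulVec x (Sum.inl i)
      = (generalMatrix (cone t H) α).mulVec x (Sum.inl i) := by
  rw [generalMatrix_mulVec, generalMatrix_mulVec, Fintype.sum_sum_type, Fintype.sum_sum_type]
  simp only [cone_adj_inl_inl, cone_adj_inl_inr]

theorem cone_mulVec_inr {t : ℕ} (H : SimpleGraph W) (α : ℝ) (x : Fin t ⊕ W → ℝ) (z : W) :
    (generalMatrix (cone t H) α).mulVec x (Sum.inr z)
      = (∑ i : Fin t, (x (Sum.inl i) + α * x (Sum.inr z))) + act α (fun z => x (Sum.inr z)) H z := by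
  rw [generalMatrix_mulVec, Fintype.sum_sum_type]
  simp only [cone_adj_inr_inl, cone_adj_inr_inr, if_true, act]

theorem cone_degree_inr (t : ℕ) (H : SimpleGraph W) (z : W) :
    (cone t H).degree (Sum.inr z) = t + H.degree z := by
  have h : (((cone t H).degree (Sum.inr z) : ℕ) : ℝ) = ((t + H.degree z : ℕ) : ℝ) := by
    push_cast
    rw [degree_eq_sum, degree_eq_sum, Fintype.sum_sum_type]
    simp only [cone_adj_inr_inl, cone_adj_inr_inr, if_true]
    simp
  exact_mod_cast h

theorem cone_degree_inl (t : ℕ) (H : SimpleGraph W) (i : Fin t) :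
    (cone t H).degree (Sum.inl i) + 1 = t + Fintype.card W := by
  have h : (((cone t H).degree (Sum.inl i) + 1 : ℕ) : ℝ) = ((t + Fintype.card W : ℕ) : ℝ) := by
    push_cast
    rw [degree_eq_sum, Fintype.sum_sum_type]
    simp only [cone_adj_inl_inr, cone_adj_inl_inl, if_true]
    have h2 : ∀ j : Fin t, (if i ≠ j then (1 : ℝ) else 0) = 1 - if i = j then 1 else 0 := by
      intro j; split_ifs <;> simp_all
    simp only [h2, Finset.sum_sub_distrib, Finset.sum_ite_eq, Finset.mem_univ, if_true]
    simp
    ring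
  exact_mod_cast h

/-- A positive vector on the vertices of `H` that detects increases of the general spectral
radius of the cone. -/
theorem exists_perron (t : ℕ) {H : SimpleGraph W} (hH : H.Connected) (α : ℝ) :
    ∃ f : W → ℝ, (∀ z, 0 < f z) ∧ ∀ H' : SimpleGraph W, quad α f H ≤ quad α f H' →
      (∃ z, act α f H z ≠ act α f H' z) → Theta (cone t H) α < Theta (cone t H') α := by
  -- The required vector is the restriction to H of the Perron vector of the cone: edges meeting
  -- `K_t` contribute the same for every H', so only `quad` and `act` on H matter.
  obtain ⟨x, hx, he⟩ := exists_pos_eigenvector (cone t H) (cone_connected hH) α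
  refine ⟨fun z => x (Sum.inr z), fun z => hx _, fun H' hq ⟨z, hz⟩ => ?_⟩
  have := (cone_connected (t := t) hH).nonempty
  refine Theta_lt_of_vector _ _ α x hx he ?_ fun h => hz ?_
  · unfold dotProduct
    rw [Fintype.sum_sum_type, Fintype.sum_sum_type]
    simp only [cone_mulVec_inl H H', cone_mulVec_inr, mul_add, Finset.sum_add_distrib]
    unfold quad at hq
    linarith
  · have := congrFun h (Sum.inr z)
    rw [cone_mulVec_inr, cone_mulVec_inr] at this
    linarith

/-- `H` is unicyclic and its cone maximizes the general spectral radius among the unicyclic graphs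
with the same degrees up to a permutation of the vertices. -/
def IsConeMaximal (α : ℝ) (t : ℕ) (H : SimpleGraph W) : Prop :=
  IsCyclic 1 H ∧ ∀ H' : SimpleGraph W, IsCyclic 1 H' →
    (∃ ρ : Equiv.Perm W, ∀ z, H'.degree (ρ z) = H.degree z) →
      Theta (cone t H') α ≤ Theta (cone t H) α

theorem degree_pos {H : SimpleGraph W} (hH : IsCyclic 1 H) (z : W) : 0 < H.degree z := by
  have h := (isCyclic_one_iff.1 hH).2
  have hn : Nontrivial W := by
    by_contra hn
    rw [not_nontrivial_iff_subsingleton] at hn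
    have h0 : ∀ z, H.degree z = 0 := fun z => by
      by_contra h0
      obtain ⟨y, hy⟩ := (H.degree_pos_iff_exists_adj z).1 (Nat.pos_of_ne_zero h0)
      exact hy.ne (Subsingleton.elim _ _)
    have := Fintype.card_pos_iff.2 ⟨z⟩
    simp only [h0, Finset.sum_const_zero] at h
    omega
  exact hH.1.preconnected.degree_pos_of_nontrivial z

theorem isCyclic_of_degree {H H' : SimpleGraph W} (hH : IsCyclic 1 H) (hc : H'.Connected)
    {u v : W} {k : ℕ}
    (hd : ∀ z, H'.degree z + (if z = v then k else 0) = H.degree z + (if z = u then k else 0)) :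
    IsCyclic 1 H' := by
  rw [isCyclic_one_iff] at hH ⊢
  refine ⟨hc, ?_⟩
  have h := Finset.sum_congr (rfl : (Finset.univ : Finset W) = Finset.univ) fun z _ => hd z
  simp only [Finset.sum_add_distrib, Finset.sum_ite_eq', Finset.mem_univ, if_true] at h
  omega

/-- In a maximal cone larger degrees come with larger entries of the Perron vector. -/
theorem lt_of_degree_lt {α : ℝ} (hα : 0 ≤ α) {t : ℕ} {H : SimpleGraph W}
    (hH : IsConeMaximal α t H) {f : W → ℝ} (hf : ∀ z, 0 < f z)
    (hper : ∀ H' : SimpleGraph W, quad α f H ≤ quad α f H' →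
      (∃ z, act α f H z ≠ act α f H' z) → Theta (cone t H) α < Theta (cone t H') α)
    {u v : W} (hd : H.degree u < H.degree v) : f u < f v := by
  by_contra hlt
  have huv : u ≠ v := by rintro rfl; omega
  have hs : (shared H u v).card ≤ H.degree u := by
    rw [card_shared_comm H u v huv, ← SimpleGraph.card_neighborFinset_eq_degree]
    exact Finset.card_le_card (shared_subset H v u)
  have hpos := degree_pos hH.1 u
  -- Moving deg v − deg u neighbours exchanges the two degrees, so the result competes with H.
  -- Enough unshared neighbours exist because at most deg u neighbours of v are shared.
  obtain ⟨H', hc, hdeg, hq, -, ha⟩ := exists_shift hα hf huv (not_lt.1 hlt)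
    (H.degree v - H.degree u) H hH.1.1 (by omega)
  have h1 := hper H' hq ⟨u, (ha (by omega)).ne⟩
  refine absurd (hH.2 H' (isCyclic_of_degree hH.1 hc hdeg) ⟨Equiv.swap u v, fun z => ?_⟩)
    (not_le.2 h1)
  by_cases hzu : z = u
  · subst hzu
    have := hdeg v
    rw [if_pos rfl, if_neg huv.symm] at this
    rw [Equiv.swap_apply_left]
    omega
  by_cases hzv : z = v
  · subst hzv
    have := hdeg u
    rw [if_pos rfl, if_neg huv] at this
    rw [Equiv.swap_apply_right]
    omega
  rw [Equiv.swap_apply_of_ne_of_ne hzu hzv]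
  have := hdeg z
  rw [if_neg hzu, if_neg hzv] at this
  omega

/-- In a maximal cone, a cycle edge `vw` cannot be switched with a pendant edge `xy`. -/
theorem no_leaf_switch {α : ℝ} (hα : 0 ≤ α) {t : ℕ} {H : SimpleGraph W}
    (hH : IsConeMaximal α t H) {v w x y : W} (hdx : H.degree v < H.degree x)
    (hxy : H.Adj x y) (hdy : H.degree y = 1) (hvw : H.Adj v w) (hxw : ¬ H.Adj x w) (hne : x ≠ w)
    (hdw : 1 < H.degree w) (hr : (H.deleteEdges {s(v, w)}).Reachable v w) : False := by
  obtain ⟨f, hf, hper⟩ := exists_perron t hH.1.1 α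
  have hfx : f v < f x := lt_of_degree_lt hα hH hf hper hdx
  have hfw : f y < f w := lt_of_degree_lt hα hH hf hper (by omega)
  have hxv : x ≠ v := by rintro rfl; omega
  have hyw : y ≠ w := by rintro rfl; omega
  have hy : ∀ z, H.Adj y z → z = x := by
    intro z hz
    rw [← SimpleGraph.card_neighborFinset_eq_degree] at hdy
    exact Finset.card_le_one.1 hdy.le z (by simpa using hz) x (by simpa using hxy.symm)
  have hvy : v ≠ y := by
    rintro rfl
    exact hne (hy w hvw).symm
  have hc1 : (slide H w v x).Connected := by
    refine slide_connected hH.1.1 hne (hr.mono ?_)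
    exact le_sup_left
  have hxy1 : (slide H w v x).Adj x y :=
    (slide_adj hne _ _).2 (Or.inl ⟨hxy, fun h => hxv h.1, fun h => hne h.1⟩)
  have hvy1 : ¬ (slide H w v x).Adj v y := by
    rw [slide_adj hne]
    rintro (h | h | h)
    · exact hxv (hy v h.1.symm).symm
    · exact hxv h.1.symm
    · exact hvw.ne h.1
  have hy1 : ∀ z, (slide H w v x).Adj y z → z = x := by
    intro z hz
    rw [slide_adj hne] at hz
    rcases hz with h | h | h
    · exact hy z h.1
    · exact absurd h.1 hxy.ne'
    · exact absurd h.1 hyw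
  have hc2 := slide_leaf_connected hc1 hxy1 hy1 hvy
  have hd1 := degree_slide hvw hxw hne hxv
  have hd2 := degree_slide hxy1 hvy1 hvy hxv.symm
  have hdeg : ∀ z, (slide (slide H w v x) y x v).degree z = H.degree z := by
    intro z
    have h1 := hd1 z
    have h2 := hd2 z
    omega
  have hq1 := quad_slide hvw hxw hne hxv α f
  have hq2 := quad_slide hxy1 hvy1 hvy hxv.symm α f
  have ha1 := act_slide hvw hxw hne hxv α f w
  have ha2 := act_slide hxy1 hvy1 hvy hxv.symm α f w
  rw [if_neg hne.symm, if_pos rfl, if_neg hvw.ne'] at ha1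
  rw [if_neg hvw.ne', if_neg hyw.symm, if_neg hne.symm] at ha2
  -- The α-terms of the two slides cancel, and the form gains 2(f x − f v)(f w − f y).
  have hlt := hper (slide (slide H w v x) y x v)
    (by nlinarith [mul_pos (sub_pos.2 hfx) (sub_pos.2 hfw)])
    ⟨w, by intro h; linarith⟩
  -- The value `k := 0` expresses that no degree changes.
  refine absurd (hH.2 _ (isCyclic_of_degree (u := v) (v := v) (k := 0) hH.1 hc2 ?_)
    ⟨Equiv.refl W, fun z => hdeg z⟩) (not_le.2 hlt)
  intro z
  simp [hdeg]

theorem card_shared_lt_degree {H : SimpleGraph W} {u x z : W} (hxz : H.Adj x z)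
    (hz : z ∉ shared H u x) : (shared H u x).card < H.degree x := by
  rw [← SimpleGraph.card_neighborFinset_eq_degree]
  exact Finset.card_lt_card (Finset.ssubset_iff_of_subset (shared_subset H u x) |>.2
    ⟨z, by simpa using hxz, hz⟩)

/-- In a maximal cone there is, for a given vertex `u`, a vertex of prescribed degree from which a
neighbour can be moved to `u`. -/
theorem exists_movable {α : ℝ} (hα : 0 ≤ α) {t : ℕ} {H : SimpleGraph W}
    (hH : IsConeMaximal α t H) {u v : W} (huv : u ≠ v) (hv2 : 2 ≤ H.degree v)
    (hle : H.degree v ≤ H.degree u)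
    (h4 : H.degree v = 2 → 4 ≤ (Finset.univ.filter fun z => 2 ≤ H.degree z).card) :
    ∃ x, u ≠ x ∧ H.degree x = H.degree v ∧ (shared H u x).card < H.degree x := by
  by_cases hgood : (shared H u v).card < H.degree v
  · exact ⟨v, huv, rfl, hgood⟩
  -- In the blocked case v has degree 2 and both its neighbours are shared: they form with u and v a
  -- triangle or a 4-cycle.
  have hs2 := card_shared_le_two hH.1 huv
  have hv : H.degree v = 2 := by omega
  have hs : shared H u v = H.neighborFinset v := by
    refine Finset.eq_of_subset_of_card_le (shared_subset H u v) ?_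
    rw [SimpleGraph.card_neighborFinset_eq_degree]
    omega
  obtain ⟨w₁, w₂, hww, hw⟩ := Finset.card_eq_two.1
    ((SimpleGraph.card_neighborFinset_eq_degree H v).trans hv)
  have hnv : ∀ z, H.Adj v z → z = w₁ ∨ z = w₂ := fun z hz => by
    have : z ∈ H.neighborFinset v := by simpa using hz
    rw [hw] at this
    simpa using this
  have h₁ : H.Adj v w₁ := by
    rw [← SimpleGraph.mem_neighborFinset, hw]; simp
  have h₂ : H.Adj v w₂ := by
    rw [← SimpleGraph.mem_neighborFinset, hw]; simp
  have hw₁ : w₁ = u ∨ H.Adj u w₁ := by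
    have : w₁ ∈ shared H u v := by rw [hs, hw]; simp
    exact (mem_shared.1 this).2
  have hw₂ : w₂ = u ∨ H.Adj u w₂ := by
    have : w₂ ∈ shared H u v := by rw [hs, hw]; simp
    exact (mem_shared.1 this).2
  have hr₁ := reachable_deleteEdges_of_shared huv hww h₁ h₂ hw₁ hw₂
  have hr₂ := reachable_deleteEdges_of_shared huv hww.symm h₂ h₁ hw₂ hw₁
  have hdeg : ∀ w, H.Adj v w → (w = u ∨ H.Adj u w) → 1 < H.degree w := by
    rintro w hvw (rfl | h)
    · omega
    · exact two_le_degree huv h.symm hvw.symm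
  by_cases hz : ∃ z, 2 ≤ H.degree z ∧ z ≠ u ∧ z ≠ v ∧ z ≠ w₁ ∧ z ≠ w₂
  · obtain ⟨z, hz2, hzu, hzv, hz₁, hz₂⟩ := hz
    obtain ⟨x, y, hxu, hxv, hx₁, hx₂, hxd, hxy, hyd⟩ := exists_adj_leaf hH.1 huv hww h₁ h₂ hnv
      hw₁ hw₂ hz2 hzu hzv hz₁ hz₂
    rcases hxd.eq_or_lt with hx2 | hx3
    · refine ⟨x, hxu.symm, by omega, card_shared_lt_degree hxy ?_⟩
      rw [mem_shared]
      rintro ⟨-, rfl | h⟩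
      · omega
      · have := two_le_degree hxu hxy.symm h.symm
        omega
    · exfalso
      -- Adjacency of x to both w₁ and w₂ would close a second cycle, so one of the cycle edges at v
      -- can be switched with the pendant edge xy.
      have hnot : ¬ (H.Adj x w₁ ∧ H.Adj x w₂) := by
        rintro ⟨hx₁', hx₂'⟩
        rcases hw₁ with rfl | hu₁
        · exact not_adj_of_two_common hH.1 hxv.symm h₁.symm hx₁'.symm
            h₂.symm hx₂'.symm (hw₂.resolve_left hww.symm)
        rcases hw₂ with rfl | hu₂
        · exact not_adj_of_two_common hH.1 hxv.symm h₂.symm hx₂'.symm h₁.symm hx₁'.symm hu₁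
        exact not_three_common hH.1 hww huv hxu.symm hxv.symm hu₁.symm h₁.symm hx₁'.symm
          hu₂.symm h₂.symm hx₂'.symm
      by_cases hx₁' : H.Adj x w₁
      · exact no_leaf_switch hα hH (by omega) hxy hyd h₂ (fun h => hnot ⟨hx₁', h⟩) hx₂
          (hdeg _ h₂ hw₂) hr₂
      · exact no_leaf_switch hα hH (by omega) hxy hyd h₁ hx₁' hx₁ (hdeg _ h₁ hw₁) hr₁
  · push Not at hz
    have hsub : (Finset.univ.filter fun z => 2 ≤ H.degree z) ⊆ {u, v, w₁, w₂} := by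
      intro z hz'
      simp only [Finset.mem_filter, Finset.mem_univ, true_and] at hz'
      simp only [Finset.mem_insert, Finset.mem_singleton]
      have := hz z hz'
      tauto
    -- All non-leaves lie on the short cycle, and there are at least four of them, so it is a
    -- 4-cycle u w₁ v w₂. If w₁ has degree 2 it can replace v; otherwise it carries a leaf, to be
    -- switched with the edge vw₂.
    have hcard := (h4 hv).trans (Finset.card_le_card hsub)
    have hu₁ : w₁ ≠ u := by
      rintro rfl
      have : ({w₁, v, w₁, w₂} : Finset W) ⊆ {w₁, v, w₂} := by
        intro z; simp only [Finset.mem_insert, Finset.mem_singleton]; tauto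
      have := (hcard.trans (Finset.card_le_card this)).trans Finset.card_le_three
      omega
    have hu₂ : w₂ ≠ u := by
      rintro rfl
      have : ({w₂, v, w₁, w₂} : Finset W) ⊆ {w₂, v, w₁} := by
        intro z; simp only [Finset.mem_insert, Finset.mem_singleton]; tauto
      have := (hcard.trans (Finset.card_le_card this)).trans Finset.card_le_three
      omega
    have ha₁ := hw₁.resolve_left hu₁
    have ha₂ := hw₂.resolve_left hu₂
    have hnw : ¬ H.Adj w₁ w₂ := fun h =>
      not_adj_of_two_common hH.1 huv ha₁.symm h₁.symm ha₂.symm h₂.symm h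
    have hnuv : ¬ H.Adj u v := fun h => by
      rcases hnv u h.symm with h | h
      · exact hu₁ h.symm
      · exact hu₂ h.symm
    rcases (two_le_degree huv ha₁.symm h₁.symm).eq_or_lt with hd | hd
    · refine ⟨w₁, hu₁.symm, by omega, card_shared_lt_degree h₁.symm ?_⟩
      rw [mem_shared]
      rintro ⟨-, h | h⟩
      · exact huv h.symm
      · exact hnuv h
    · exfalso
      have hlt : ({u, v} : Finset W).card < (H.neighborFinset w₁).card := by
        rw [SimpleGraph.card_neighborFinset_eq_degree]
        exact lt_of_le_of_lt Finset.card_le_two hd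
      obtain ⟨y, hy, hy'⟩ := Finset.exists_mem_notMem_of_card_lt_card hlt
      rw [SimpleGraph.mem_neighborFinset] at hy
      simp only [Finset.mem_insert, Finset.mem_singleton, not_or] at hy'
      have hyd : H.degree y = 1 := by
        have hp := degree_pos hH.1 y
        by_contra hne
        have := hz y (by omega) hy'.1 hy'.2 hy.ne'
        subst this
        exact hnw hy
      exact no_leaf_switch hα hH (by omega) hy hyd h₂ hnw hww (hdeg _ h₂ hw₂) hr₂

/-- A unit of degree can be transferred in a maximal cone so that the general spectral radius
increases. -/
theorem exists_unit_transfer {α : ℝ} (hα : 0 ≤ α) {t : ℕ} {H : SimpleGraph W}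
    (hH : IsConeMaximal α t H) {u v : W} (huv : u ≠ v) (hv2 : 2 ≤ H.degree v)
    (hle : H.degree v ≤ H.degree u)
    (h4 : H.degree v = 2 → 4 ≤ (Finset.univ.filter fun z => 2 ≤ H.degree z).card) :
    ∃ H' : SimpleGraph W, IsCyclic 1 H' ∧
      (∃ ρ : Equiv.Perm W, ∀ z, H'.degree (ρ z) + (if z = v then 1 else 0)
        = H.degree z + (if z = u then 1 else 0)) ∧
      Theta (cone t H) α < Theta (cone t H') α := by
  obtain ⟨x, hux, hdx, hs⟩ := exists_movable hα hH huv hv2 hle h4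
  obtain ⟨f, hf, hper⟩ := exists_perron t hH.1.1 α
  rcases le_or_gt (f x) (f u) with hfx | hfx
  · obtain ⟨H', hc, hdeg, hq, -, ha⟩ := exists_shift hα hf hux hfx 1 H hH.1.1 (by omega)
    refine ⟨H', isCyclic_of_degree hH.1 hc hdeg, ⟨Equiv.swap v x, fun z => ?_⟩,
      hper H' hq ⟨u, (ha one_pos).ne⟩⟩
    have := hdeg (Equiv.swap v x z)
    grind
  -- Here the Perron entries favour x, so maximality forces equal degrees and a neighbour is moved
  -- from u to x. The permutation relabels x as u, after v and x have been exchanged.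
  · have hdux : H.degree u = H.degree x := by
      by_contra hne
      exact absurd (lt_of_degree_lt hα hH hf hper (u := x) (v := u) (by omega)) (not_lt.2 hfx.le)
    obtain ⟨H', hc, hdeg, hq, -, ha⟩ := exists_shift hα hf hux.symm hfx.le 1 H hH.1.1
      (by rw [card_shared_comm H x u hux.symm]; omega)
    refine ⟨H', isCyclic_of_degree hH.1 hc hdeg,
      ⟨(Equiv.swap v x).trans (Equiv.swap u x), fun z => ?_⟩,
      hper H' hq ⟨x, (ha one_pos).ne⟩⟩
    have := hdeg (Equiv.swap u x (Equiv.swap v x z))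
    rw [Equiv.trans_apply]
    grind

end Cone

/-! ### Unit transfers between majorized sequences -/

section Majorization

variable {n : ℕ}

theorem StrictlyMajorizedBy.sum_le {π π' : Fin n → ℕ} (h : StrictlyMajorizedBy π π') (k : ℕ) :
    ∑ i : Fin n with i.val < k, π i ≤ ∑ i : Fin n with i.val < k, π' i := by
  rcases Nat.eq_zero_or_pos k with rfl | hk
  · simp
  rcases Nat.lt_or_ge k n with hkn | hkn
  · exact h.2.2 k hk (by omega)
  · have : (Finset.univ.filter fun i : Fin n => i.val < k) = Finset.univ :=
      Finset.filter_true_of_mem fun i _ => by omega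
    rw [this]
    exact h.2.1.le

theorem sum_filter_lt_split (f : Fin n → ℕ) {j k : ℕ} (hjk : j ≤ k) :
    ∑ i : Fin n with i.val < k, f i
      = ∑ i : Fin n with i.val < j, f i + ∑ i : Fin n with j ≤ i.val ∧ i.val < k, f i := by
  rw [← Finset.sum_union]
  · refine Finset.sum_congr ?_ fun _ _ => rfl
    ext i
    simp only [Finset.mem_union, Finset.mem_filter, Finset.mem_univ, true_and]
    omega
  · rw [Finset.disjoint_filter]
    intro i _ h1 h2
    omega

/-- A non-increasing sequence that is strictly majorized by another one can be brought closer to it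
by transferring one unit from a later to an earlier entry. -/
theorem StrictlyMajorizedBy.exists_transfer {π π' : Fin n → ℕ} (hπ : Antitone π)
    (hπ' : Antitone π') (h : StrictlyMajorizedBy π π') :
    ∃ (p q : Fin n) (π₁ : Fin n → ℕ), p < q ∧ π p < π' p ∧ π' q < π q ∧
      (∀ i, π₁ i + (if i = q then 1 else 0) = π i + (if i = p then 1 else 0)) ∧
      Antitone π₁ ∧ (π₁ = π' ∨ StrictlyMajorizedBy π₁ π') := by
  classical
  -- At the first disagreement p the prefix sums force π p < π' p, and every earlier entry exceeds π
  -- p, so raising π p keeps the order.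
  obtain ⟨p, hp, hpmin⟩ : ∃ p, π p ≠ π' p ∧ ∀ i, i < p → π i = π' i := by
    have hne : (Finset.univ.filter fun i => π i ≠ π' i).Nonempty := by
      obtain ⟨i, hi⟩ := Function.ne_iff.1 h.1
      exact ⟨i, by simpa using hi⟩
    refine ⟨_, (Finset.mem_filter.1 (Finset.min'_mem _ hne)).2, fun i hi => ?_⟩
    by_contra hcon
    exact absurd (Finset.min'_le _ i (by simpa using hcon)) (not_le.2 hi)
  have hpp : π p < π' p := by
    refine lt_of_le_of_ne ?_ hp
    have h1 := h.sum_le (p.val + 1)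
    rw [sum_filter_lt_split π (Nat.le_succ p.val), sum_filter_lt_split π' (Nat.le_succ p.val)] at h1
    have h2 : ∑ i : Fin n with i.val < p.val, π i = ∑ i : Fin n with i.val < p.val, π' i :=
      Finset.sum_congr rfl fun i hi => hpmin i (Finset.mem_filter.1 hi).2
    have h3 : (Finset.univ.filter fun i : Fin n => p.val ≤ i.val ∧ i.val < p.val + 1) = {p} := by
      ext i
      simp only [Finset.mem_filter, Finset.mem_univ, true_and, Finset.mem_singleton, Fin.ext_iff]
      omega
    rw [Nat.succ_eq_add_one, h3, Finset.sum_singleton, Finset.sum_singleton] at h1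
    omega
  obtain ⟨r, hr, hrmin⟩ : ∃ r, π' r < π r ∧ ∀ i, i < r → π i ≤ π' i := by
    have hne : (Finset.univ.filter fun i => π' i < π i).Nonempty := by
      by_contra hcon
      rw [Finset.not_nonempty_iff_eq_empty, Finset.filter_eq_empty_iff] at hcon
      have hlt : ∑ i, π i < ∑ i, π' i :=
        Finset.sum_lt_sum (fun i hi => not_lt.1 (hcon hi)) ⟨p, Finset.mem_univ _, hpp⟩
      exact absurd h.2.1 hlt.ne
    refine ⟨_, (Finset.mem_filter.1 (Finset.min'_mem _ hne)).2, fun i hi => ?_⟩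
    by_contra hcon
    exact absurd (Finset.min'_le _ i (by simpa using hcon)) (not_le.2 hi)
  -- The last index of the block on which π equals π r can be lowered without breaking monotonicity.
  obtain ⟨q, hq, hqmax⟩ : ∃ q, π q = π r ∧ ∀ i, π i = π r → i ≤ q := by
    have hne : (Finset.univ.filter fun i => π i = π r).Nonempty := ⟨r, by simp⟩
    exact ⟨_, (Finset.mem_filter.1 (Finset.max'_mem _ hne)).2,
      fun i hi => Finset.le_max' _ i (by simpa using hi)⟩
  have hpr : p < r := by
    rcases lt_trichotomy p r with h1 | h1 | h1
    · exact h1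
    · subst h1; omega
    · have := hpmin r h1; omega
  have hrq : r ≤ q := hqmax r rfl
  have hpq : p < q := lt_of_lt_of_le hpr hrq
  have hqq : π' q < π q := by have := hπ' hrq; omega
  have hafter : ∀ i, q < i → π i < π q := fun i hi =>
    lt_of_le_of_ne (hπ hi.le) fun hcon => absurd (hqmax i (by omega)) (not_le.2 hi)
  -- The transfer adds 1 to exactly these prefix sums, so strictness is needed. Up to r it holds
  -- termwise; beyond r, the entries from k to q are larger in π, so equality at k would violate the
  -- inequality at q + 1.
  have hstrict : ∀ k, p.val < k → k ≤ q.val →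
      ∑ i : Fin n with i.val < k, π i < ∑ i : Fin n with i.val < k, π' i := by
    intro k hpk hkq
    rcases le_or_gt k r.val with hkr | hkr
    · refine Finset.sum_lt_sum (fun i hi => hrmin i ?_) ⟨p, by simpa using hpk, hpp⟩
      have := (Finset.mem_filter.1 hi).2
      exact Fin.lt_def.2 (by omega)
    · have h1 := h.sum_le (q.val + 1)
      rw [sum_filter_lt_split π (j := k) (by omega),
        sum_filter_lt_split π' (j := k) (by omega)] at h1
      have h2 : ∑ i : Fin n with k ≤ i.val ∧ i.val < q.val + 1, π' i
          < ∑ i : Fin n with k ≤ i.val ∧ i.val < q.val + 1, π i := by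
        refine Finset.sum_lt_sum_of_nonempty ⟨q, by simpa using hkq⟩ fun i hi => ?_
        have hi' := (Finset.mem_filter.1 hi).2
        have e1 : π' i ≤ π' r := hπ' (Fin.le_def.2 (by omega))
        have e2 : π q ≤ π i := hπ (Fin.le_def.2 (by omega))
        omega
      omega
  have hπ₁ : ∀ i, (if i = p then π p + 1 else if i = q then π q - 1 else π i)
      + (if i = q then 1 else 0) = π i + (if i = p then 1 else 0) := by
    intro i
    by_cases h1 : i = p
    · subst h1; simp [hpq.ne]
    · by_cases h2 : i = q
      · subst h2; simp [hpq.ne']; omega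
      · simp [h1, h2]
  refine ⟨p, q, fun i => if i = p then π p + 1 else if i = q then π q - 1 else π i, hpq, hpp, hqq,
    hπ₁, ?_, ?_⟩
  · intro i j hij
    have hi := hπ₁ i
    have hj := hπ₁ j
    have hm := hπ hij
    simp only at hi hj ⊢
    by_cases hjp : j = p
    · by_cases hip : i = p
      · rw [hip, hjp]
      · have h1 : i < p := lt_of_le_of_ne (hjp ▸ hij) hip
        have h2 := hpmin i h1
        have h3 := hπ' h1.le
        have h4 : i ≠ q := (h1.trans hpq).ne
        simp only [hjp, if_true, hip, h4, if_false]
        omega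
    · by_cases hiq : i = q
      · by_cases hjq : j = q
        · rw [hiq, hjq]
        · have h1 : q < j := lt_of_le_of_ne (hiq ▸ hij) (Ne.symm hjq)
          have h2 := hafter j h1
          simp only [hjp, hjq, hiq, hpq.ne', if_true, if_false]
          omega
      · rw [if_neg hjp, if_neg hiq]
        split_ifs <;> first | omega | (subst_vars; omega)
  · by_cases heq : (fun i => if i = p then π p + 1 else if i = q then π q - 1 else π i) = π'
    · exact Or.inl heq
    refine Or.inr ⟨heq, ?_, fun k _ _ => ?_⟩
    · have h1 := Finset.sum_congr (rfl : (Finset.univ : Finset (Fin n)) = Finset.univ)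
        fun i _ => hπ₁ i
      simp only [Finset.sum_add_distrib, Finset.sum_ite_eq', Finset.mem_univ, if_true] at h1
      have := h.2.1
      simp only
      omega
    · have h1 := Finset.sum_congr
        (rfl : (Finset.univ.filter fun i : Fin n => i.val < k) = _) fun i _ => hπ₁ i
      simp only [Finset.sum_add_distrib, Finset.sum_ite_eq', Finset.mem_filter, Finset.mem_univ,
        true_and] at h1
      have h2 := h.sum_le k
      have h3 := hstrict k
      have h4 := Fin.lt_def.1 hpq
      simp only
      split_ifs at h1 <;> omega

end Majorization

/-! ### Degree sequences of cones and the induction -/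

section Transport

open scoped Classical

/-- If all non-leaves lay in {a, b}, the degree sum would give deg a + deg b ≥ |W| + 2. Then a and b
would have a common neighbour, a non-leaf different from both. -/
theorem three_le_card_not_leaf {W : Type*} [Fintype W] {H : SimpleGraph W} (hH : IsCyclic 1 H)
    (hW : 2 ≤ Fintype.card W) : 3 ≤ (Finset.univ.filter fun z => 2 ≤ H.degree z).card := by
  by_contra hlt
  obtain ⟨s, hs, hs2⟩ := Finset.exists_superset_card_eq
    (s := Finset.univ.filter fun z => 2 ≤ H.degree z) (n := 2) (by omega) hW
  obtain ⟨a, b, hab, rfl⟩ := Finset.card_eq_two.1 hs2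
  have hsum := (isCyclic_one_iff.1 hH).2
  rw [← Finset.sum_add_sum_compl {a, b}, Finset.sum_pair hab] at hsum
  have h1 : ∑ z ∈ ({a, b} : Finset W)ᶜ, H.degree z ≤ ({a, b} : Finset W)ᶜ.card * 1 :=
    Finset.sum_le_card_nsmul _ _ _ fun z hz => by
      by_contra hcon
      exact (Finset.mem_compl.1 hz) (hs (by simp; omega))
  rw [Finset.card_compl, Finset.card_pair hab] at h1
  have h2 := Finset.card_union_add_card_inter (H.neighborFinset a) (H.neighborFinset b)
  rw [SimpleGraph.card_neighborFinset_eq_degree, SimpleGraph.card_neighborFinset_eq_degree] at h2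
  have h3 := Finset.card_le_univ (H.neighborFinset a ∪ H.neighborFinset b)
  obtain ⟨c, hc⟩ := Finset.card_pos.1
    (show 0 < (H.neighborFinset a ∩ H.neighborFinset b).card by omega)
  simp only [Finset.mem_inter, SimpleGraph.mem_neighborFinset] at hc
  have h4 := hs (Finset.mem_filter.2 ⟨Finset.mem_univ c, two_le_degree hab hc.1.symm hc.2.symm⟩)
  simp only [Finset.mem_insert, Finset.mem_singleton] at h4
  rcases h4 with rfl | rfl
  · exact hc.1.ne rfl
  · exact hc.2.ne rfl

theorem degree_iso {V W : Type*} [Fintype V] [Fintype W] {G : SimpleGraph V} {H : SimpleGraph W}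
    (e : G ≃g H) (v : V) : H.degree (e v) = G.degree v := by
  have h : ((H.degree (e v) : ℕ) : ℝ) = ((G.degree v : ℕ) : ℝ) := by
    rw [degree_eq_sum, degree_eq_sum]
    refine (Fintype.sum_equiv e.toEquiv _ _ fun w => ?_).symm
    have : H.Adj (e v) (e w) ↔ G.Adj v w := e.map_adj_iff
    simp [this]
  exact_mod_cast h

variable {n t : ℕ}

theorem exists_cone_of_mem_Gam {π : Fin n → ℕ} {G : SimpleGraph (Fin n)} (hG : G ∈ Gam π t 1) :
    ∃ (m : ℕ) (H : SimpleGraph (Fin m)) (τ : Fin n ≃ Fin t ⊕ Fin m), IsCyclic 1 H ∧ t + m = n ∧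
      (∀ i, (cone t H).degree (τ i) = π i) ∧ ∀ α, Theta G α = Theta (cone t H) α := by
  obtain ⟨⟨m, H, hH, ⟨e⟩⟩, -, σ, hσ⟩ := hG
  refine ⟨m, H, σ.trans e.toEquiv, hH, ?_, fun i => ?_, fun α => Theta_eq_of_iso e α⟩
  · have := Fintype.card_congr e.toEquiv
    simp only [Fintype.card_sum, Fintype.card_fin] at this
    exact this.symm
  · rw [← hσ i]
    exact degree_iso e (σ i)

theorem exists_mem_Gam_of_cone {π : Fin n → ℕ} (hπ : Antitone π) {m : ℕ} {H : SimpleGraph (Fin m)}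
    (hH : IsCyclic 1 H) (τ : Fin n ≃ Fin t ⊕ Fin m)
    (hτ : ∀ i, (cone t H).degree (τ i) = π i) :
    ∃ G ∈ Gam π t 1, ∀ α, Theta G α = Theta (cone t H) α := by
  let e : (cone t H).comap τ ≃g cone t H := SimpleGraph.Iso.comap τ (cone t H)
  refine ⟨(cone t H).comap τ, ⟨⟨m, H, hH, ⟨e⟩⟩, hπ, Equiv.refl _, fun i => ?_⟩,
    fun α => Theta_eq_of_iso e α⟩
  rw [← hτ i]
  exact (degree_iso e i).symm

theorem cone_degree_sumCongr {W : Type*} [Fintype W] {H H' : SimpleGraph W} (ρ : Equiv.Perm W)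
    {u v : W} {k : ℕ}
    (hρ : ∀ z, H'.degree (ρ z) + (if z = v then k else 0)
      = H.degree z + (if z = u then k else 0)) (x : Fin t ⊕ W) :
    (cone t H').degree (Equiv.sumCongr (Equiv.refl _) ρ x) + (if x = Sum.inr v then k else 0)
      = (cone t H).degree x + (if x = Sum.inr u then k else 0) := by
  rcases x with i | z
  · have h1 := cone_degree_inl t H i
    have h2 := cone_degree_inl t H' i
    change (cone t H').degree (Sum.inl i) + _ = _
    simp only [reduceCtorEq, if_false]
    omega
  · have h := hρ z
    change (cone t H').degree (Sum.inr (ρ z)) + _ = _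
    simp only [Sum.inr.injEq, cone_degree_inr]
    omega

/-- A vertex of `K_t` has degree t + m − 1, which is at least t + 2 once m ≥ 3; a vertex of H
reaches t + 2 exactly when it is not a leaf of H. -/
theorem card_filter_cone_degree {π : Fin n → ℕ} {m : ℕ} {H : SimpleGraph (Fin m)} (hm : 3 ≤ m)
    (τ : Fin n ≃ Fin t ⊕ Fin m) (hτ : ∀ i, (cone t H).degree (τ i) = π i) :
    (Finset.univ.filter fun i => t + 2 ≤ π i).card
      = t + (Finset.univ.filter fun z => 2 ≤ H.degree z).card := by
  have h1 : (Finset.univ.filter fun i => t + 2 ≤ π i).card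
      = (Finset.univ.filter fun x => t + 2 ≤ (cone t H).degree x).card := by
    refine Finset.card_equiv τ fun i => ?_
    simp [hτ]
  have h2 : ∀ i : Fin t, t + 2 ≤ (cone t H).degree (Sum.inl i) := fun i => by
    have := cone_degree_inl t H i
    rw [Fintype.card_fin] at this
    omega
  rw [h1, Finset.card_filter, Fintype.sum_sum_type, Finset.card_filter]
  simp only [h2, if_true, cone_degree_inr, add_le_add_iff_left]
  simp

/-- Vertices of `K_t` are adjacent to all others, hence have degree n − 1. -/
theorem exists_inr_of_degree_lt {π : Fin n → ℕ} {m : ℕ} {H : SimpleGraph (Fin m)} (hm : t + m = n)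
    (τ : Fin n ≃ Fin t ⊕ Fin m) (hτ : ∀ i, (cone t H).degree (τ i) = π i) {i : Fin n}
    (hi : π i + 1 < n) : ∃ z, τ i = Sum.inr z := by
  rcases h : τ i with j | z
  · have h1 := cone_degree_inl t H j
    have h2 := hτ i
    rw [h] at h2
    rw [Fintype.card_fin] at h1
    omega
  · exact ⟨z, rfl⟩

theorem bounds_of_mem_Gam (ht : t + 4 ≤ n) {π : Fin n → ℕ} {G : SimpleGraph (Fin n)}
    (hG : G ∈ Gam π t 1) :
    (∀ i, t + 1 ≤ π i) ∧ (∀ i, π i + 1 ≤ n) ∧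
      t + 3 ≤ (Finset.univ.filter fun i => t + 2 ≤ π i).card := by
  obtain ⟨m, H, τ, hH, hm, hτ, -⟩ := exists_cone_of_mem_Gam hG
  refine ⟨fun i => ?_, fun i => ?_, ?_⟩
  · rw [← hτ i]
    rcases τ i with j | z
    · have := cone_degree_inl t H j
      rw [Fintype.card_fin] at this
      omega
    · have := degree_pos hH z
      rw [cone_degree_inr]
      omega
  · have := (cone t H).degree_lt_card_verts (τ i)
    rw [hτ, Fintype.card_sum, Fintype.card_fin, Fintype.card_fin] at this
    omega
  · rw [card_filter_cone_degree (by omega) τ hτ]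
    have := three_le_card_not_leaf hH (by rw [Fintype.card_fin]; omega)
    omega

theorem isConeMaximal_of_isThetaMaximal {α : ℝ} {π : Fin n → ℕ} {G : SimpleGraph (Fin n)}
    (hG : IsThetaMaximal α (Gam π t 1) G) {m : ℕ} {H : SimpleGraph (Fin m)} (hH : IsCyclic 1 H)
    (τ : Fin n ≃ Fin t ⊕ Fin m) (hτ : ∀ i, (cone t H).degree (τ i) = π i)
    (hTheta : Theta G α = Theta (cone t H) α) : IsConeMaximal α t H := by
  refine ⟨hH, fun H' hH' ⟨ρ, hρ⟩ => ?_⟩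
  obtain ⟨G', hG', hT⟩ := exists_mem_Gam_of_cone (t := t) hG.1.2.1 hH'
    (τ.trans (Equiv.sumCongr (Equiv.refl _) ρ)) (fun i => by
      obtain ⟨z⟩ := hH.1.nonempty
      have h1 := cone_degree_sumCongr (t := t) (H := H) (H' := H') (u := z) (v := z) (k := 0) ρ
        (fun y => by simp [hρ y]) (τ i)
      simp only [ite_self, add_zero] at h1
      rw [Equiv.trans_apply, h1, hτ i])
  rw [← hT, ← hTheta]
  exact hG.2 G' hG'

theorem exists_isThetaMaximal (α : ℝ) {𝒢 : Set (SimpleGraph (Fin n))} (h : 𝒢.Nonempty) :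
    ∃ G, IsThetaMaximal α 𝒢 G :=
  Set.exists_max_image 𝒢 (fun G => Theta G α) (Set.toFinite 𝒢) h

theorem exists_Theta_lt_of_transfer (ht : t + 4 ≤ n) {α : ℝ} (hα : 0 ≤ α) {π π' π₁ : Fin n → ℕ}
    {G G' : SimpleGraph (Fin n)} (hG : IsThetaMaximal α (Gam π t 1) G) (hG' : G' ∈ Gam π' t 1)
    {p q : Fin n} (hpq : p < q) (hp : π p < π' p) (hq : π' q < π q)
    (hπ₁ : ∀ i, π₁ i + (if i = q then 1 else 0) = π i + (if i = p then 1 else 0))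
    (hanti : Antitone π₁) : ∃ G₁ ∈ Gam π₁ t 1, Theta G α < Theta G₁ α := by
  obtain ⟨m, H, τ, hH, hm, hτ, hT⟩ := exists_cone_of_mem_Gam hG.1
  obtain ⟨hlow, hup, hthree⟩ := bounds_of_mem_Gam ht hG'
  have hmax := isConeMaximal_of_isThetaMaximal hG hH τ hτ (hT α)
  have hπ := hG.1.2.1
  have hπ' := hG'.2.1
  have hle := hπ hpq.le
  have hpn := hup p
  have hql := hlow q
  -- The bounds π q ≤ π p < π' p ≤ n − 1 place both vertices in H, and π q > π' q ≥ t + 1 makes v a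
  -- non-leaf there.
  obtain ⟨u, hu⟩ := exists_inr_of_degree_lt hm τ hτ (i := p) (by omega)
  obtain ⟨v, hv⟩ := exists_inr_of_degree_lt hm τ hτ (i := q) (by omega)
  have hdu := hτ p
  have hdv := hτ q
  rw [hu, cone_degree_inr] at hdu
  rw [hv, cone_degree_inr] at hdv
  have huv : u ≠ v := by
    rintro rfl
    exact hpq.ne (τ.injective (hu.trans hv.symm))
  obtain ⟨H', hH', ⟨ρ, hρ⟩, hlt⟩ := exists_unit_transfer hα hmax huv (by omega) (by omega) (by
    intro h2
    have h3 := card_filter_cone_degree (by omega) τ hτ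
    -- The sequence π' has at least t + 3 entries that are at least t + 2. When π q = t + 2 they all
    -- precede q, so they are such entries of π too, and q is one more: H has at least four
    -- non-leaves.
    have h4 : insert q (Finset.univ.filter fun i => t + 2 ≤ π' i)
        ⊆ Finset.univ.filter fun i => t + 2 ≤ π i := by
      intro i hi
      simp only [Finset.mem_insert, Finset.mem_filter, Finset.mem_univ, true_and] at hi ⊢
      rcases hi with rfl | hi
      · omega
      · have hiq : i ≤ q := by
          by_contra hcon
          have := hπ' (not_le.1 hcon).le
          omega
        have := hπ hiq
        omega
    have h5 := Finset.card_le_card h4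
    rw [Finset.card_insert_of_notMem (by simp; omega)] at h5
    omega)
  obtain ⟨G₁, hG₁, hT₁⟩ := exists_mem_Gam_of_cone (t := t) hanti hH'
    (τ.trans (Equiv.sumCongr (Equiv.refl _) ρ)) (fun i => by
      have h1 := cone_degree_sumCongr (t := t) ρ hρ (τ i)
      have h2 := hπ₁ i
      rw [hτ i, ← hu, ← hv] at h1
      simp only [τ.apply_eq_iff_eq] at h1
      rw [Equiv.trans_apply]
      split_ifs at h1 h2 <;> omega)
  exact ⟨G₁, hG₁, by rw [hT, hT₁]; exact hlt⟩

/-- Induction on the ℓ¹ distance between π and π', written with truncated subtraction. A transfer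
lowers it because p rises towards, and q falls towards, its target. -/
theorem exists_Theta_lt (ht : t + 4 ≤ n) {α : ℝ} (hα : 0 ≤ α) {π' : Fin n → ℕ}
    {G' : SimpleGraph (Fin n)} (hG' : G' ∈ Gam π' t 1) (d : ℕ) :
    ∀ (π : Fin n → ℕ) (G : SimpleGraph (Fin n)),
      ∑ i, ((π i - π' i) + (π' i - π i)) = d → StrictlyMajorizedBy π π' →
      IsThetaMaximal α (Gam π t 1) G → ∃ G₁ ∈ Gam π' t 1, Theta G α < Theta G₁ α := by
  induction d using Nat.strong_induction_on with
  | _ d ih =>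
    intro π G hd hmaj hG
    obtain ⟨p, q, π₁, hpq, hp, hq, hπ₁, hanti, hor⟩ := hmaj.exists_transfer hG.1.2.1 hG'.2.1
    obtain ⟨G₁, hG₁, hlt⟩ := exists_Theta_lt_of_transfer ht hα hG hG' hpq hp hq hπ₁ hanti
    rcases hor with rfl | hmaj₁
    · exact ⟨G₁, hG₁, hlt⟩
    obtain ⟨G₂, hG₂⟩ := exists_isThetaMaximal α ⟨G₁, hG₁⟩
    have hdist : ∑ i, ((π₁ i - π' i) + (π' i - π₁ i)) < d := by
      rw [← hd]
      refine Finset.sum_lt_sum (fun i _ => ?_) ⟨p, Finset.mem_univ _, ?_⟩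
      · have h1 := hπ₁ i
        by_cases hip : i = p
        · subst hip
          rw [if_neg hpq.ne, if_pos rfl] at h1
          omega
        by_cases hiq : i = q
        · subst hiq
          rw [if_neg hip, if_pos rfl] at h1
          omega
        rw [if_neg hip, if_neg hiq] at h1
        omega
      · have h1 := hπ₁ p
        rw [if_neg hpq.ne, if_pos rfl] at h1
        omega
    obtain ⟨G₃, hG₃, hlt'⟩ := ih _ hdist π₁ G₂ rfl hmaj₁ hG₂
    exact ⟨G₃, hG₃, (hlt.trans_le (hG₂.2 G₁ hG₁)).trans hlt'⟩

end Transport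

end TCone

theorem theorem5p6 (n t : ℕ) (ht : t + 4 ≤ n) (α : ℝ) (hα : 0 ≤ α)
    (π π' : Fin n → ℕ)
    (hmaj : TCone.StrictlyMajorizedBy π π')
    (G G' : SimpleGraph (Fin n))
    (hG : TCone.IsThetaMaximal α (TCone.Gam π t 1) G)
    (hG' : TCone.IsThetaMaximal α (TCone.Gam π' t 1) G') :
    TCone.Theta G α < TCone.Theta G' α := by
  obtain ⟨G₁, hG₁, hlt⟩ := TCone.exists_Theta_lt ht hα hG'.1 _ π G rfl hmaj hG
  exact hlt.trans_le (hG'.2 G₁ hG₁)
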